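/- Let $\mathbb F$ be a field of odd characteristic $p$ and let $L(X)$ be the free Lie algebra over $\mathbb F$ on $X=\{x,y,z\}$. Write $(\mathrm{ad}\,x)(u)=[u,x]$, set $$h=x+[y,z]+(\mathrm{ad}\,x)^p(z)\in L(X),$$ and let $L=L(X)/\langle h\rangle$, where $\langle h\rangle$ is the ideal of $L(X)$ generated by $h$. Then: 1. $L$ is not a free Lie algebra (on any set). 2. There is a Hopf algebra isomorphism between the universal enveloping algebra $U(L)$ and the free associative unital $\mathbb F$-algebra on $2$ generators. Here $U(L)$ carries its standard Hopf algebra structure, in which the elements of $L$ are primitive, and the free associative algebra carries the Hopf algebra structure in which its free generators are primitive. 3. The minimal number of elements required to generate $L$ as a Lie algebra is $3$. -/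

import Mathlib

universe w u v

open scoped TensorProduct

noncomputable section

/-! ### Hopf algebras generated by elements on which the antipode axioms hold -/

namespace HopfAux

variable {R A : Type*} [CommRing R] [Ring A] [Bialgebra R A]

/-- The linear map underlying an algebra homomorphism into the opposite algebra. -/
def antiLin (S : A →ₐ[R] Aᵐᵒᵖ) : A →ₗ[R] A :=
  (MulOpposite.opLinearEquiv R).symm.toLinearMap ∘ₗ S.toLinearMap

theorem antiLin_mul (S : A →ₐ[R] Aᵐᵒᵖ) (a b : A) :
    antiLin S (a * b) = antiLin S b * antiLin S a := by
  simp [antiLin]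

theorem antiLin_algebraMap (S : A →ₐ[R] Aᵐᵒᵖ) (r : R) :
    antiLin S (algebraMap R A r) = algebraMap R A r := by
  simp [antiLin, AlgHom.commutes]

open Coalgebra Bialgebra

theorem left_mul (S : A →ₐ[R] Aᵐᵒᵖ) (u v : A ⊗[R] A) (r : R)
    (hu : LinearMap.mul' R A ((antiLin S).rTensor A u) = algebraMap R A r) :
    LinearMap.mul' R A ((antiLin S).rTensor A (u * v)) =
      r • LinearMap.mul' R A ((antiLin S).rTensor A v) := by
  induction v using TensorProduct.induction_on with
  | zero => simp
  | add v w hv hw => simp only [mul_add, map_add, hv, hw, smul_add]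
  | tmul c d =>
    have key : ∀ u : A ⊗[R] A, LinearMap.mul' R A ((antiLin S).rTensor A (u * c ⊗ₜ[R] d)) =
        antiLin S c * LinearMap.mul' R A ((antiLin S).rTensor A u) * d := by
      intro u
      induction u using TensorProduct.induction_on with
      | zero => simp
      | add v w hv hw => simp only [add_mul, mul_add, map_add, hv, hw]
      | tmul a b => simp [antiLin_mul, mul_assoc]
    rw [key, hu, ← Algebra.commutes, mul_assoc, ← Algebra.smul_def]
    simp

theorem right_mul (S : A →ₐ[R] Aᵐᵒᵖ) (u v : A ⊗[R] A) (r : R)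
    (hv : LinearMap.mul' R A ((antiLin S).lTensor A v) = algebraMap R A r) :
    LinearMap.mul' R A ((antiLin S).lTensor A (u * v)) =
      r • LinearMap.mul' R A ((antiLin S).lTensor A u) := by
  induction u using TensorProduct.induction_on with
  | zero => simp
  | add v w hv hw => simp only [add_mul, map_add, hv, hw, smul_add]
  | tmul c d =>
    have key : ∀ v : A ⊗[R] A, LinearMap.mul' R A ((antiLin S).lTensor A (c ⊗ₜ[R] d * v)) =
        c * LinearMap.mul' R A ((antiLin S).lTensor A v) * antiLin S d := by
      intro u
      induction u using TensorProduct.induction_on with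
      | zero => simp
      | add v w hv hw => simp only [add_mul, mul_add, map_add, hv, hw]
      | tmul a b => simp [antiLin_mul, mul_assoc]
    rw [key, hv, ← Algebra.commutes, mul_assoc, ← Algebra.smul_def]
    simp

/-- If `A` is generated by a set `s` of primitive elements and the anti-homomorphism `S` is `-1`
on `s`, then `S` is an antipode. -/
theorem antipode_axioms (S : A →ₐ[R] Aᵐᵒᵖ) (s : Set A) (hs : Algebra.adjoin R s = ⊤)
    (hΔ : ∀ a ∈ s, comul (R := R) a = a ⊗ₜ[R] 1 + 1 ⊗ₜ[R] a)
    (hε : ∀ a ∈ s, counit (R := R) a = 0)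
    (hS : ∀ a ∈ s, S a = MulOpposite.op (-a)) (a : A) :
    LinearMap.mul' R A ((antiLin S).rTensor A (comul a)) = algebraMap R A (counit a) ∧
    LinearMap.mul' R A ((antiLin S).lTensor A (comul a)) = algebraMap R A (counit a) := by
  have ha : a ∈ Algebra.adjoin R s := hs ▸ Algebra.mem_top
  have h1 : antiLin S 1 = 1 := by simp [antiLin]
  induction ha using Algebra.adjoin_induction with
  | mem x hx =>
    have h2 : antiLin S x = -x := by simp [antiLin, hS x hx]
    simp [hΔ x hx, hε x hx, h1, h2]
  | algebraMap r =>
    simp [Algebra.TensorProduct.algebraMap_apply, antiLin_algebraMap, h1]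
  | add x y _ _ hx hy => simp [hx.1, hx.2, hy.1, hy.2]
  | mul x y _ _ hx hy =>
    constructor
    · rw [Bialgebra.comul_mul, left_mul S _ _ _ hx.1, hy.1, Bialgebra.counit_mul, map_mul,
        Algebra.smul_def]
    · rw [Bialgebra.comul_mul, right_mul S _ _ _ hy.2, hx.2, Bialgebra.counit_mul, map_mul,
        Algebra.smul_def, Algebra.commutes]

end HopfAux

/-! ### The Hopf algebra structure of the free associative algebra -/

namespace FreeAlgebra

variable (R : Type*) [CommRing R] (X : Type*)

/-- The bialgebra structure on `FreeAlgebra R X` in which every free generator is primitive. -/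
instance instBialgebraPrimitive : Bialgebra R (FreeAlgebra R X) :=
  .ofAlgHom
    (lift R fun x => ι R x ⊗ₜ[R] 1 + 1 ⊗ₜ[R] ι R x)
    (lift R fun _ => 0)
    (by
      ext x
      simp [Algebra.TensorProduct.one_def, TensorProduct.add_tmul, TensorProduct.tmul_add]
      abel)
    (by ext x; simp)
    (by ext x; simp)

theorem comul_ι (x : X) :
    Coalgebra.comul (R := R) (ι R x) = ι R x ⊗ₜ[R] 1 + 1 ⊗ₜ[R] ι R x :=
  lift_ι_apply _ x

theorem counit_ι (x : X) : Coalgebra.counit (R := R) (ι R x) = 0 :=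
  lift_ι_apply (fun _ : X => (0 : R)) x

/-- The anti-endomorphism sending every free generator to its negative. -/
def antipodeHom : FreeAlgebra R X →ₐ[R] (FreeAlgebra R X)ᵐᵒᵖ :=
  lift R fun x => MulOpposite.op (-ι R x)

theorem antipodeHom_axioms (a : FreeAlgebra R X) :
    LinearMap.mul' R (FreeAlgebra R X) ((HopfAux.antiLin (antipodeHom R X)).rTensor _ (Coalgebra.comul a)) =
      algebraMap R (FreeAlgebra R X) (Coalgebra.counit a) ∧
    LinearMap.mul' R (FreeAlgebra R X) ((HopfAux.antiLin (antipodeHom R X)).lTensor _ (Coalgebra.comul a)) =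
      algebraMap R (FreeAlgebra R X) (Coalgebra.counit a) :=
  HopfAux.antipode_axioms (antipodeHom R X) (Set.range (ι R)) (adjoin_range_ι R X)
    (by rintro _ ⟨x, rfl⟩; exact comul_ι R X x) (by rintro _ ⟨x, rfl⟩; exact counit_ι R X x)
    (by rintro _ ⟨x, rfl⟩; exact lift_ι_apply _ x) a

/-- The Hopf algebra structure on `FreeAlgebra R X` in which every free generator is primitive. -/
instance instHopfAlgebraPrimitive : HopfAlgebra R (FreeAlgebra R X) where
  antipode := HopfAux.antiLin (antipodeHom R X)
  mul_antipode_rTensor_comul := LinearMap.ext fun a => (antipodeHom_axioms R X a).1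
  mul_antipode_lTensor_comul := LinearMap.ext fun a => (antipodeHom_axioms R X a).2

theorem antipode_ι (x : X) : HopfAlgebra.antipode R (ι R x) = -ι R x := by
  change HopfAux.antiLin (antipodeHom R X) (ι R x) = _
  simp [HopfAux.antiLin, antipodeHom]

end FreeAlgebra

/-! ### The Hopf algebra structure of the universal enveloping algebra -/

namespace UniversalEnvelopingAlgebra

attribute [local instance 100] LieRing.ofAssociativeRing

variable (R : Type*) [CommRing R] (L : Type*) [LieRing L] [LieAlgebra R L]

theorem algHom_ext {A : Type*} [Ring A] [Algebra R A]
    {f g : UniversalEnvelopingAlgebra R L →ₐ[R] A} (h : ∀ x : L, f (ι R x) = g (ι R x)) :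
    f = g := by
  apply hom_ext
  ext x
  exact h x

/-- `a ↦ a ⊗ 1 + 1 ⊗ a`, as a homomorphism of Lie algebras. -/
def comulLie :
    L →ₗ⁅R⁆ (UniversalEnvelopingAlgebra R L ⊗[R] UniversalEnvelopingAlgebra R L) where
  toFun a := ι R a ⊗ₜ[R] 1 + 1 ⊗ₜ[R] ι R a
  map_add' a b := by
    simp only [map_add, TensorProduct.add_tmul, TensorProduct.tmul_add]
    abel
  map_smul' r a := by
    simp only [map_smul, RingHom.id_apply, smul_add, TensorProduct.smul_tmul',
      TensorProduct.tmul_smul]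
  map_lie' {a b} := by
    simp only [LieHom.map_lie, LieRing.of_associative_ring_bracket, TensorProduct.sub_tmul,
      TensorProduct.tmul_sub, add_mul, mul_add, Algebra.TensorProduct.tmul_mul_tmul, one_mul,
      mul_one]
    abel

/-- `a ↦ -a`, as a homomorphism of Lie algebras into the opposite algebra. -/
def antipodeLie : L →ₗ⁅R⁆ (UniversalEnvelopingAlgebra R L)ᵐᵒᵖ where
  toFun a := MulOpposite.op (-ι R a)
  map_add' a b := by simp only [map_add, neg_add, MulOpposite.op_add]
  map_smul' r a := by simp only [map_smul, RingHom.id_apply, ← smul_neg, MulOpposite.op_smul]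
  map_lie' {a b} := by
    simp only [LieHom.map_lie, LieRing.of_associative_ring_bracket, ← MulOpposite.op_mul,
      ← MulOpposite.op_sub, neg_mul_neg, neg_sub]

/-- The bialgebra structure on the enveloping algebra in which every element of the Lie algebra
is primitive; its counit is the augmentation map. -/
instance instBialgebraPrimitive : Bialgebra R (UniversalEnvelopingAlgebra R L) :=
  .ofAlgHom
    (lift R (comulLie R L))
    (lift R (0 : L →ₗ⁅R⁆ R))
    (by
      apply algHom_ext
      intro x
      have h : lift R (comulLie R L) (ι R x) = ι R x ⊗ₜ[R] 1 + 1 ⊗ₜ[R] ι R x :=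
        lift_ι_apply R _ x
      simp only [AlgHom.comp_apply, h, map_add,
        Algebra.TensorProduct.map_tmul, map_one, AlgHom.coe_id, id_eq, AlgEquiv.coe_toAlgHom,
        Algebra.TensorProduct.one_def, TensorProduct.add_tmul, TensorProduct.tmul_add,
        Algebra.TensorProduct.assoc_tmul]
      abel)
    (by
      apply algHom_ext
      intro x
      have h : lift R (comulLie R L) (ι R x) = ι R x ⊗ₜ[R] 1 + 1 ⊗ₜ[R] ι R x :=
        lift_ι_apply R _ x
      have h0 : lift R (0 : L →ₗ⁅R⁆ R) (ι R x) = 0 := lift_ι_apply R _ x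
      simp [-ι_apply, h, h0])
    (by
      apply algHom_ext
      intro x
      have h : lift R (comulLie R L) (ι R x) = ι R x ⊗ₜ[R] 1 + 1 ⊗ₜ[R] ι R x :=
        lift_ι_apply R _ x
      have h0 : lift R (0 : L →ₗ⁅R⁆ R) (ι R x) = 0 := lift_ι_apply R _ x
      simp [-ι_apply, h, h0])

theorem comul_ι (x : L) :
    Coalgebra.comul (R := R) (ι R x) = ι R x ⊗ₜ[R] 1 + 1 ⊗ₜ[R] ι R x :=
  lift_ι_apply R (comulLie R L) x

theorem counit_ι (x : L) : Coalgebra.counit (R := R) (ι R x) = 0 :=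
  lift_ι_apply R (0 : L →ₗ⁅R⁆ R) x

theorem adjoin_range_ι : Algebra.adjoin R (Set.range (ι R : L → _)) = ⊤ := by
  set S := Algebra.adjoin R (Set.range (ι R : L → UniversalEnvelopingAlgebra R L)) with hS
  let f : L →ₗ⁅R⁆ S :=
    { toFun := fun a => ⟨ι R a, Algebra.subset_adjoin ⟨a, rfl⟩⟩
      map_add' := fun a b => Subtype.ext (map_add (ι R) a b)
      map_smul' := fun r a => Subtype.ext (map_smul (ι R) r a)
      map_lie' := fun {a b} => Subtype.ext (LieHom.map_lie (ι R) a b) }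
  have h : S.val.comp (lift R f) = AlgHom.id R _ := by
    apply hom_ext
    ext x
    exact congrArg Subtype.val (lift_ι_apply R f x)
  refine eq_top_iff.2 fun a _ => ?_
  have h2 : ((lift R f a : S) : UniversalEnvelopingAlgebra R L) = a := DFunLike.congr_fun h a
  exact h2 ▸ (lift R f a).2

theorem antipodeHom_axioms (a : UniversalEnvelopingAlgebra R L) :
    LinearMap.mul' R (UniversalEnvelopingAlgebra R L) ((HopfAux.antiLin (lift R (antipodeLie R L))).rTensor _ (Coalgebra.comul a)) =
      algebraMap R (UniversalEnvelopingAlgebra R L) (Coalgebra.counit a) ∧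
    LinearMap.mul' R (UniversalEnvelopingAlgebra R L) ((HopfAux.antiLin (lift R (antipodeLie R L))).lTensor _ (Coalgebra.comul a)) =
      algebraMap R (UniversalEnvelopingAlgebra R L) (Coalgebra.counit a) :=
  HopfAux.antipode_axioms (lift R (antipodeLie R L)) (Set.range (ι R : L → _))
    (adjoin_range_ι R L)
    (by rintro _ ⟨x, rfl⟩; exact comul_ι R L x) (by rintro _ ⟨x, rfl⟩; exact counit_ι R L x)
    (by rintro _ ⟨x, rfl⟩; exact lift_ι_apply R (antipodeLie R L) x) a

/-- The Hopf algebra structure on the enveloping algebra in which every element of the Lie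
algebra is primitive. -/
instance instHopfAlgebraPrimitive : HopfAlgebra R (UniversalEnvelopingAlgebra R L) where
  antipode := HopfAux.antiLin (lift R (antipodeLie R L))
  mul_antipode_rTensor_comul := LinearMap.ext fun a => (antipodeHom_axioms R L a).1
  mul_antipode_lTensor_comul := LinearMap.ext fun a => (antipodeHom_axioms R L a).2

theorem antipode_ι (x : L) : HopfAlgebra.antipode R (ι R x) = -ι R x := by
  change (lift R (antipodeLie R L) (ι R x)).unop = _
  rw [lift_ι_apply]
  rfl

end UniversalEnvelopingAlgebra

/-! ### The Lie algebra of the example -/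

namespace OneRelator

/-- The adjoint map in the convention `(ad a)(b) = [b, a]`. -/
def adR (F : Type*) {M : Type*} [CommRing F] [LieRing M] [LieAlgebra F M] (a : M) :
    Module.End F M where
  toFun b := ⁅b, a⁆
  map_add' b c := add_lie b c a
  map_smul' r b := smul_lie r b a

variable (F : Type*) [Field F] (p : ℕ)

/-- The free Lie algebra on three letters: `x = of 0`, `y = of 1`, `z = of 2`. -/
abbrev Free3 := FreeLieAlgebra F (Fin 3)

/-- The element `h = x + [y, z] + (ad x)^p (z)`. -/
def relator : Free3 F :=
  FreeLieAlgebra.of F 0 + ⁅(FreeLieAlgebra.of F 1 : Free3 F), (FreeLieAlgebra.of F 2 : Free3 F)⁆ +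
    (adR F (FreeLieAlgebra.of F 0 : Free3 F) ^ p) (FreeLieAlgebra.of F 2)

/-- The ideal of the free Lie algebra generated by `h`. -/
abbrev relIdeal : LieIdeal F (Free3 F) := LieSubmodule.lieSpan F (Free3 F) {relator F p}

/-- The quotient Lie algebra `L = L(x, y, z) / ⟨h⟩`. -/
abbrev QuotLie := Free3 F ⧸ relIdeal F p

end OneRelator

/-- The Lie algebra `M` is free, on a set of free generators in the universe `w`. -/
def IsFreeLieAlgebra (F : Type u) (M : Type v) [CommRing F] [LieRing M]
    [LieAlgebra F M] : Prop :=
  ∃ Y : Type w, Nonempty (FreeLieAlgebra F Y ≃ₗ⁅F⁆ M)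

/-- A Hopf algebra isomorphism exists: a bijective map which respects multiplication, unit,
comultiplication, counit and antipode. -/
def HopfIsomorphic (F A B : Type*) [CommRing F] [Ring A] [Ring B] [HopfAlgebra F A]
    [HopfAlgebra F B] : Prop :=
  ∃ φ : A ≃ₐc[F] B, ∀ a : A, φ (HopfAlgebra.antipode F a) = HopfAlgebra.antipode F (φ a)

/-- `M` can be generated, as a Lie algebra, by a set of exactly `n` elements. -/
def GeneratedBy (F M : Type*) [CommRing F] [LieRing M] [LieAlgebra F M] (n : ℕ) : Prop :=
  ∃ s : Finset M, s.card = n ∧ LieSubalgebra.lieSpan F M (s : Set M) = ⊤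

end

/-! In an associative algebra of characteristic `p` one has `(ad x)^p (z) = z x^p - x^p z`. Hence in
`U(L)` the relation `h = 0` reads `x = z a - a z` with `a = y - x^p`. So `x` is redundant, and
`U(L)` is free on `a` and `b = z` (`freeEquiv`). Both are primitive, because the `p`-th power of a
primitive element is primitive in characteristic `p`; the isomorphism therefore respects the Hopf
structures.

The heart of the matter is that no two elements generate `L` (`lieSpan_pair_ne_top`). Put `w = b a -
a b`. In the free algebra on `a, b` the image of `L` consists of elements `f + c w^p`, where `f` is
a Lie element and `c` is the coefficient of `a` in `f` (`IsTwisted`). Two elements generating `L`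
would give two such elements `u, v` generating the free algebra; this is refuted by induction on
`deg u + deg v`. The leading components of `u, v` must satisfy a relation, since otherwise the
degree-one letters could not be expressed (`top_dependent`). A Euclidean algorithm in the free
algebra then makes them scalar multiples of powers `t^i, t^j` (`exists_eq_smul_pow`). If `i = j`,
subtracting a multiple of `v` from `u` lowers the degree.

If `i > j`, the leading component of `u` is a proper power. A Poincaré–Birkhoff–Witt argument shows
that nonzero Lie elements are not proper powers (`IsLie.eq_one_of_eq_pow`), so the term `c w^p` must
contribute. Comparing exponents (`IsLie.pow_eq_of_add_smul_pow`) leaves only `deg u = 2p` and `v = β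
b + ε w` with `ε ≠ 0`. A representation killing `v` then contradicts generation.

Finally, the abelianization of `L` is spanned by `y` and `z`. A free generating set would thus have
at most two elements, and `L` would be generated by two elements after all. -/

/-! ### The length grading of the free algebra -/

namespace FreeAlgebra

open Polynomial

variable {F : Type*} [Field F] {X : Type*}

variable (F X) in
/-- The length grading of the free algebra, recorded as the homomorphism `x ↦ x T` to the
polynomial ring over it. -/
noncomputable def grade : FreeAlgebra F X →ₐ[F] (FreeAlgebra F X)[X] :=
  lift F fun x => monomial 1 (ι F x)

@[simp]
theorem grade_ι (x : X) : grade F X (ι F x) = monomial 1 (ι F x) := by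
  simp [grade]

variable (F X) in
/-- The space of linear combinations of words of length `n`. -/
noncomputable def words (n : ℕ) : Submodule F (FreeAlgebra F X) :=
  Submodule.span F (Set.range (ι F)) ^ n

theorem one_mem_words : (1 : FreeAlgebra F X) ∈ words F X 0 := by
  rw [words, pow_zero]
  exact Submodule.one_le.1 le_rfl

theorem algebraMap_mem_words (c : F) : algebraMap F (FreeAlgebra F X) c ∈ words F X 0 := by
  rw [Algebra.algebraMap_eq_smul_one]
  exact Submodule.smul_mem _ _ one_mem_words

theorem mem_words_zero {f : FreeAlgebra F X} :
    f ∈ words F X 0 ↔ ∃ c : F, f = algebraMap F _ c := by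
  rw [words, pow_zero, Submodule.mem_one]
  exact ⟨fun ⟨c, h⟩ => ⟨c, h.symm⟩, fun ⟨c, h⟩ => ⟨c, h.symm⟩⟩

theorem ι_mem_words (x : X) : ι F x ∈ words F X 1 := by
  rw [words, pow_one]
  exact Submodule.subset_span ⟨x, rfl⟩

theorem mul_mem_words {m n : ℕ} {f g : FreeAlgebra F X} (hf : f ∈ words F X m)
    (hg : g ∈ words F X n) : f * g ∈ words F X (m + n) := by
  rw [words, pow_add]
  exact Submodule.mul_mem_mul hf hg

theorem grade_eq_monomial {n : ℕ} {f : FreeAlgebra F X} (hf : f ∈ words F X n) :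
    grade F X f = monomial n f := by
  induction n generalizing f with
  | zero =>
    obtain ⟨c, rfl⟩ := mem_words_zero.1 hf
    rw [AlgHom.commutes]
    rfl
  | succ n ih =>
    rw [words, pow_succ] at hf
    refine Submodule.mul_induction_on hf (fun g hg h hh => ?_) (fun g h hg hh => ?_)
    · have : grade F X h = monomial 1 h := by
        refine Submodule.span_induction (fun y hy => ?_) (by simp) (fun y z _ _ hy hz => ?_)
          (fun c y _ hy => ?_) hh
        · obtain ⟨x, rfl⟩ := hy
          exact grade_ι x
        · rw [map_add, hy, hz, map_add]
        · rw [map_smul, hy, smul_monomial]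
      rw [map_mul, ih hg, this, monomial_mul_monomial]
    · simp [hg, hh]

theorem coeff_grade_mem (f : FreeAlgebra F X) (n : ℕ) : (grade F X f).coeff n ∈ words F X n := by
  induction f using FreeAlgebra.induction generalizing n with
  | grade0 r =>
    rw [grade_eq_monomial (algebraMap_mem_words r), coeff_monomial]
    split_ifs with h
    · exact h ▸ algebraMap_mem_words r
    · exact zero_mem _
  | grade1 x =>
    rw [grade_ι, coeff_monomial]
    split_ifs with h
    · exact h ▸ ι_mem_words x
    · exact zero_mem _
  | mul f g hf hg =>
    rw [map_mul, coeff_mul]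
    refine sum_mem fun ij hij => ?_
    rw [← Finset.HasAntidiagonal.mem_antidiagonal.1 hij]
    exact mul_mem_words (hf _) (hg _)
  | add f g hf hg =>
    rw [map_add, coeff_add]
    exact add_mem (hf n) (hg n)

/-- Evaluation at `1` is multiplicative despite the noncommuting coefficients, because `1` is
central. It is a left inverse of `grade`, so passing to components loses nothing. -/
theorem eval_grade (f : FreeAlgebra F X) : (grade F X f).eval 1 = f := by
  induction f using FreeAlgebra.induction with
  | grade0 r =>
    rw [grade_eq_monomial (algebraMap_mem_words r)]
    simp
  | grade1 x => simp
  | mul f g hf hg =>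
    rw [map_mul, eval, eval₂_mul_noncomm _ _ fun _ => Commute.one_right _]
    exact congrArg₂ (· * ·) hf hg
  | add f g hf hg => rw [map_add, eval_add, hf, hg]

theorem grade_injective : Function.Injective (grade F X) :=
  Function.LeftInverse.injective eval_grade

theorem grade_ne_zero {f : FreeAlgebra F X} (hf : f ≠ 0) : grade F X f ≠ 0 :=
  fun h => hf (grade_injective (by rw [h, map_zero]))

theorem words_disjoint {m n : ℕ} {f : FreeAlgebra F X} (hf : f ≠ 0) (hm : f ∈ words F X m)
    (hn : f ∈ words F X n) : m = n := by
  have h := (grade_eq_monomial hm).symm.trans (grade_eq_monomial hn)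
  by_contra hmn
  have h2 := congrArg (coeff · m) h
  simp only [coeff_monomial] at h2
  rw [if_pos trivial, if_neg (Ne.symm hmn)] at h2
  exact hf h2

variable (F X) in
/-- The degree of an element of the free algebra, for the length grading. -/
noncomputable def deg (f : FreeAlgebra F X) : ℕ := (grade F X f).natDegree

variable (F X) in
/-- The leading homogeneous component of an element of the free algebra. -/
noncomputable def top (f : FreeAlgebra F X) : FreeAlgebra F X := (grade F X f).leadingCoeff

theorem top_mem (f : FreeAlgebra F X) : top F X f ∈ words F X (deg F X f) := coeff_grade_mem _ _

theorem top_ne_zero {f : FreeAlgebra F X} (hf : f ≠ 0) : top F X f ≠ 0 :=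
  leadingCoeff_ne_zero.2 (grade_ne_zero hf)

theorem mem_words_zero_of_deg {f : FreeAlgebra F X} (h : deg F X f = 0) : f ∈ words F X 0 := by
  have h1 := eval_grade f
  rw [eq_C_of_natDegree_eq_zero h, eval_C] at h1
  exact h1 ▸ coeff_grade_mem f 0

/-! ### Stripping the last letter -/

variable (F X) in
/-- The coefficient of the empty word. -/
noncomputable def aug : FreeAlgebra F X →ₐ[F] F := lift F fun _ => 0

@[simp]
theorem aug_ι (x : X) : aug F X (ι F x) = 0 := by simp [aug]

theorem aug_words_succ {n : ℕ} {f : FreeAlgebra F X} (hf : f ∈ words F X (n + 1)) :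
    aug F X f = 0 := by
  rw [words, pow_succ] at hf
  refine Submodule.mul_induction_on hf (fun g hg h hh => ?_) (fun g h hg hh => ?_)
  · have : aug F X h = 0 := by
      refine Submodule.span_induction (fun y hy => ?_) (by simp) (fun y z _ _ hy hz => ?_)
          (fun c y _ hy => ?_) hh
      · obtain ⟨x, rfl⟩ := hy
        exact aug_ι x
      · simp [hy, hz]
      · simp [hy]
    rw [map_mul, this, mul_zero]
  · simp [hg, hh]

open Classical in
/-- The homomorphism to triangular matrices whose off-diagonal entry is `strip`. -/
noncomputable def stripHom (c : X) : FreeAlgebra F X →ₐ[F] Matrix (Fin 2) (Fin 2) (FreeAlgebra F X) :=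
  lift F fun x => !![ι F x, if x = c then 1 else 0; 0, 0]

theorem stripHom_entries (c : X) (f : FreeAlgebra F X) :
    stripHom c f 0 0 = f ∧ stripHom c f 1 0 = 0 ∧
      stripHom c f 1 1 = algebraMap F _ (aug F X f) := by
  induction f using FreeAlgebra.induction with
  | grade0 r => simp [Matrix.algebraMap_matrix_apply]
  | grade1 x => simp [stripHom]
  | mul f g hf hg => simp [Matrix.mul_apply, hf, hg]
  | add f g hf hg => simp [hf, hg]

/-- The linear map which removes the last letter `c` from the words ending in `c` and kills all
other words. -/
noncomputable def strip (c : X) (f : FreeAlgebra F X) : FreeAlgebra F X := stripHom c f 0 1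

theorem strip_add (c : X) (f g : FreeAlgebra F X) : strip c (f + g) = strip c f + strip c g := by
  simp [strip]

/-- This is the corner entry of a product of triangular matrices. When `g` has no constant term,
only `g` is stripped and `f` stays as a left factor. -/
theorem strip_mul (c : X) (f g : FreeAlgebra F X) :
    strip c (f * g) = f * strip c g + strip c f * algebraMap F _ (aug F X g) := by
  simp [strip, Matrix.mul_apply, (stripHom_entries c _).1, (stripHom_entries c _).2.2]

open Classical in
theorem strip_ι (c x : X) : strip c (ι F x) = if x = c then 1 else 0 := by
  simp [strip, stripHom]

theorem strip_algebraMap (c : X) (r : F) : strip c (algebraMap F (FreeAlgebra F X) r) = 0 := by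
  simp [strip, Matrix.algebraMap_matrix_apply]

theorem strip_smul (c : X) (r : F) (f : FreeAlgebra F X) : strip c (r • f) = r • strip c f := by
  simp [strip]

theorem eq_aug_add_sum_strip [Fintype X] (f : FreeAlgebra F X) :
    f = algebraMap F _ (aug F X f) + ∑ c, strip c f * ι F c := by
  classical
  induction f using FreeAlgebra.induction with
  | grade0 r => simp [strip_algebraMap]
  | grade1 x => simp [strip_ι]
  | mul f g hf hg =>
    simp only [strip_mul, add_mul, Finset.sum_add_distrib, mul_assoc, ← Finset.mul_sum]
    have h1 : ∑ c, strip c f * (algebraMap F (FreeAlgebra F X) (aug F X g) * ι F c) =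
        (∑ c, strip c f * ι F c) * algebraMap F _ (aug F X g) := by
      rw [Finset.sum_mul]
      exact Finset.sum_congr rfl fun c _ => by rw [mul_assoc, Algebra.commutes]
    rw [h1, eq_sub_of_add_eq' hg.symm, eq_sub_of_add_eq' hf.symm, map_mul, map_mul]
    noncomm_ring
  | add f g hf hg =>
    simp only [strip_add, add_mul, Finset.sum_add_distrib, map_add]
    nth_rw 1 [hf, hg]
    abel

theorem strip_mem_words (c : X) {n : ℕ} {f : FreeAlgebra F X} (hf : f ∈ words F X (n + 1)) :
    strip c f ∈ words F X n := by
  classical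
  rw [words, pow_succ] at hf
  refine Submodule.mul_induction_on hf (fun g hg h hh => ?_) (fun g h hg hh => ?_)
  · refine Submodule.span_induction (fun y hy => ?_) (by simp [strip]) (fun y z _ _ hy hz => ?_)
          (fun r y _ hy => ?_) hh
    · obtain ⟨x, rfl⟩ := hy
      rw [strip_mul, strip_ι, aug_ι, map_zero, mul_zero, add_zero]
      split_ifs
      · rwa [mul_one]
      · rw [mul_zero]
        exact zero_mem _
    · rw [mul_add, strip_add]
      exact add_mem hy hz
    · rw [mul_smul_comm, strip_smul]
      exact Submodule.smul_mem _ _ hy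
  · rw [strip_add]
    exact add_mem hg hh

/-! ### Dependent homogeneous elements -/

variable [Fintype X]

/-- Stripping the same letter from `x` and `y` preserves the relation and the left factors `f, g`.
After `k` strippings `x` has become a nonzero scalar, and the relation can be solved for `f`. -/
theorem exists_eq_mul_of_words {d k : ℕ} {f g x y : FreeAlgebra F X} (hx : x ∈ words F X k)
    (hx0 : x ≠ 0) (hy : y ∈ words F X (k + d)) (h : f * x + g * y = 0) :
    ∃ q ∈ words F X d, f = g * q := by
  induction k generalizing x y with
  | zero =>
    obtain ⟨c, rfl⟩ := mem_words_zero.1 hx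
    have hc : c ≠ 0 := fun h => hx0 (by rw [h, map_zero])
    refine ⟨-(c⁻¹ • y), neg_mem (Submodule.smul_mem _ _ (by simpa using hy)), ?_⟩
    rw [mul_neg, mul_smul_comm, eq_neg_of_add_eq_zero_right h, ← Algebra.commutes,
      ← Algebra.smul_def, smul_neg, smul_smul, inv_mul_cancel₀ hc, one_smul, neg_neg]
  | succ k ih =>
    have hy' : y ∈ words F X (k + d + 1) := by rwa [add_right_comm]
    -- A nonzero element without constant term has a word ending in some letter.
    obtain ⟨c, hc⟩ : ∃ c, strip c x ≠ 0 := by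
      by_contra! hc
      apply hx0
      rw [eq_aug_add_sum_strip x, aug_words_succ hx]
      simp [hc]
    refine ih (strip_mem_words c hx) hc (strip_mem_words c hy') ?_
    have := congrArg (strip c) h
    rwa [strip_add, strip_mul, strip_mul, aug_words_succ hx, aug_words_succ hy', map_zero,
      mul_zero, mul_zero, add_zero, add_zero, ← map_zero (algebraMap F _), strip_algebraMap] at this

/-- Since `f` and `g` are homogeneous, each homogeneous component of the relation is again a
relation. It suffices to take one that involves a nonzero component of `x`. -/
theorem exists_eq_mul {d n : ℕ} {f g x y : FreeAlgebra F X} (hf : f ∈ words F X (n + d))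
    (hg : g ∈ words F X n) (hx0 : x ≠ 0) (h : f * x + g * y = 0) :
    ∃ q ∈ words F X d, f = g * q := by
  have hG := grade_ne_zero hx0
  obtain ⟨k, hk⟩ : ∃ k, (grade F X x).coeff k ≠ 0 := by
    by_contra! hk
    exact hG (Polynomial.ext hk)
  refine exists_eq_mul_of_words (coeff_grade_mem x k) hk (coeff_grade_mem y (k + d)) ?_
  have h2 := congrArg (coeff · (k + d + n)) (congrArg (grade F X) h)
  simp only [map_add, map_mul, grade_eq_monomial hf, grade_eq_monomial hg, coeff_add, map_zero,
    coeff_zero] at h2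
  rw [coeff_monomial_mul, show k + d + n = k + (n + d) by ring, coeff_monomial_mul] at h2
  exact h2

theorem mem_adjoin_pair {R B : Type*} [CommRing R] [Ring B] [Algebra R B] {f g s : B}
    (hs : s ∈ Algebra.adjoin R {f, g}) :
    ∃ c : R, ∃ x ∈ Algebra.adjoin R {f, g}, ∃ y ∈ Algebra.adjoin R {f, g},
      s = algebraMap R B c + f * x + g * y := by
  have h0 := zero_mem (Algebra.adjoin R {f, g})
  induction hs using Algebra.adjoin_induction with
  | mem x hx =>
    rcases hx with rfl | rfl
    · exact ⟨0, 1, one_mem _, 0, h0, by simp⟩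
    · exact ⟨0, 0, h0, 1, one_mem _, by simp⟩
  | algebraMap r => exact ⟨r, 0, h0, 0, h0, by simp⟩
  | add a b _ _ ha hb =>
    obtain ⟨c, x, hx, y, hy, rfl⟩ := ha
    obtain ⟨c', x', hx', y', hy', rfl⟩ := hb
    refine ⟨c + c', x + x', add_mem hx hx', y + y', add_mem hy hy', ?_⟩
    simp only [map_add, mul_add]
    abel
  | mul a b _ hb ha hb' =>
    obtain ⟨c, x, hx, y, hy, rfl⟩ := ha
    obtain ⟨c', x', hx', y', hy', hb'⟩ := hb'
    refine ⟨c * c', c • x' + x * b, add_mem (Subalgebra.smul_mem _ hx' c) (mul_mem hx hb),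
      c • y' + y * b, add_mem (Subalgebra.smul_mem _ hy' c) (mul_mem hy hb), ?_⟩
    rw [add_mul, add_mul, mul_add, mul_add, mul_assoc, mul_assoc, hb', mul_add, mul_add, map_mul,
      mul_smul_comm, mul_smul_comm, Algebra.smul_def, Algebra.smul_def]
    abel

/-- Euclid's algorithm on degrees. For `n ≤ m`, `exists_eq_mul` gives `f = g q`, and cancelling `g`
leaves `q x + y = 0`. As `y` lies in the algebra generated by `f` and `g` and has no constant term,
it has the form `g y'`. The result is a relation between `q` and `g`, whose degrees have a smaller
sum. -/
theorem exists_eq_smul_pow {m n : ℕ} (hm : 1 ≤ m) (hn : 1 ≤ n) {f g x y : FreeAlgebra F X}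
    (hf : f ∈ words F X m) (hg : g ∈ words F X n) (hf0 : f ≠ 0) (hg0 : g ≠ 0)
    (hx : x ∈ Algebra.adjoin F {f, g}) (hy : y ∈ Algebra.adjoin F {f, g}) (hx0 : x ≠ 0)
    (h : f * x + g * y = 0) :
    ∃ (t : FreeAlgebra F X) (r i j : ℕ) (α β : F), 1 ≤ i ∧ 1 ≤ j ∧ f = α • t ^ i ∧
      g = β • t ^ j ∧ m = i * r ∧ n = j * r := by
  induction hN : m + n using Nat.strong_induction_on generalizing m n f g x y with
  | _ N ih =>
    wlog hmn : n ≤ m generalizing m n f g x y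
    · have hy0 : y ≠ 0 := by
        rintro rfl
        rw [mul_zero, add_zero] at h
        exact (mul_ne_zero hf0 hx0) h
      rw [Set.pair_comm] at hx hy
      rw [add_comm] at h hN
      obtain ⟨t, r, i, j, α, β, h1, h2, h3, h4, h5, h6⟩ :=
        this hn hm hg hf hg0 hf0 hy hx hy0 h hN (by omega)
      exact ⟨t, r, j, i, β, α, h2, h1, h4, h3, h6, h5⟩
    obtain ⟨d, rfl⟩ := Nat.exists_eq_add_of_le hmn
    obtain ⟨q, hq, rfl⟩ := exists_eq_mul hf hg hx0 h
    rcases Nat.eq_zero_or_pos d with rfl | hd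
    · obtain ⟨c, rfl⟩ := mem_words_zero.1 hq
      exact ⟨g, n, 1, 1, c, 1, le_rfl, le_rfl,
        by rw [← Algebra.commutes, ← Algebra.smul_def, pow_one], by simp, by simp, by simp⟩
    have hq0 : q ≠ 0 := right_ne_zero_of_mul hf0
    have h2 : q * x + y = 0 := by
      rw [mul_assoc, ← mul_add] at h
      exact (mul_eq_zero.1 h).resolve_left hg0
    have hle : Algebra.adjoin F {g * q, g} ≤ Algebra.adjoin F {q, g} := by
      refine Algebra.adjoin_le ?_
      rintro z (rfl | rfl)
      · exact mul_mem (Algebra.subset_adjoin (by simp)) (Algebra.subset_adjoin (by simp))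
      · exact Algebra.subset_adjoin (by simp)
    obtain ⟨c, y0, hy0, y1, hy1, rfl⟩ := mem_adjoin_pair hy
    have hgaug : aug F X g = 0 := by
      obtain ⟨k, rfl⟩ := Nat.exists_eq_add_of_le' hn
      exact aug_words_succ hg
    have hqaug : aug F X q = 0 := by
      obtain ⟨k, rfl⟩ := Nat.exists_eq_add_of_le' hd
      exact aug_words_succ hq
    have hc : c = 0 := by
      have := congrArg (aug F X) h2
      simpa [hgaug, hqaug] using this
    subst hc
    obtain ⟨t, r, i, j, α, β, h3, h4, h5, h6, h7, h8⟩ :=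
      ih (d + n) (by omega) hd hn hq hg hq0 hg0 (hle hx)
        (add_mem (mul_mem (Algebra.subset_adjoin (by simp)) (hle hy0)) (hle hy1)) hx0
        (y := q * y0 + y1) (by rw [← h2, map_zero]; noncomm_ring) rfl
    refine ⟨t, r, i + j, j, β * α, β, by omega, h4, ?_, h6, by rw [h7, h8]; ring, h8⟩
    rw [h5, h6, smul_mul_smul_comm, ← pow_add, add_comm]

end FreeAlgebra

/-! ### Leading components of a pair of generators -/

namespace FreeAlgebra

open Polynomial

variable {F : Type*} [Field F] {X : Type*}

/-- `Filt u v N s`: the element `s` is a polynomial expression in `u` and `v` all of whose terms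
have formal degree at most `N`. -/
inductive Filt (u v : FreeAlgebra F X) : ℕ → FreeAlgebra F X → Prop
  | scalar (N : ℕ) (c : F) : Filt u v N (algebraMap F _ c)
  | left {N : ℕ} {s : FreeAlgebra F X} : Filt u v N s → Filt u v (N + deg F X u) (u * s)
  | right {N : ℕ} {s : FreeAlgebra F X} : Filt u v N s → Filt u v (N + deg F X v) (v * s)
  | add {N : ℕ} {s t : FreeAlgebra F X} : Filt u v N s → Filt u v N t → Filt u v N (s + t)

namespace Filt

variable {u v : FreeAlgebra F X}

theorem zero (N : ℕ) : Filt u v N 0 := by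
  rw [← map_zero (algebraMap F (FreeAlgebra F X))]
  exact scalar N 0

theorem smul {N : ℕ} {s : FreeAlgebra F X} (h : Filt u v N s) (c : F) : Filt u v N (c • s) := by
  induction h with
  | scalar N d =>
    rw [Algebra.smul_def, ← map_mul]
    exact scalar N _
  | left _ ih =>
    rw [← mul_smul_comm]
    exact ih.left
  | right _ ih =>
    rw [← mul_smul_comm]
    exact ih.right
  | add _ _ h1 h2 =>
    rw [smul_add]
    exact h1.add h2

theorem mono {N M : ℕ} {s : FreeAlgebra F X} (h : Filt u v N s) (hNM : N ≤ M) :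
    Filt u v M s := by
  obtain ⟨k, rfl⟩ := Nat.exists_eq_add_of_le hNM
  clear hNM
  induction h with
  | scalar N d => exact scalar _ d
  | left _ ih =>
    rw [add_right_comm]
    exact ih.left
  | right _ ih =>
    rw [add_right_comm]
    exact ih.right
  | add _ _ h1 h2 => exact h1.add h2

theorem exists_of_mem_adjoin {s : FreeAlgebra F X} (hs : s ∈ Algebra.adjoin F {u, v}) :
    ∃ N, Filt u v N s := by
  -- The constructors of `Filt` only multiply on the left by one generator, so the induction has to
  -- carry an arbitrary right factor.
  suffices H : ∀ x, (∃ N, Filt u v N x) → ∃ N, Filt u v N (s * x) by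
    simpa using H 1 ⟨0, by simpa using scalar (u := u) (v := v) 0 1⟩
  induction hs using Algebra.adjoin_induction with
  | mem y hy =>
    rintro x ⟨N, hN⟩
    rcases hy with rfl | rfl
    · exact ⟨_, hN.left⟩
    · exact ⟨_, hN.right⟩
  | algebraMap r =>
    rintro x ⟨N, hN⟩
    exact ⟨N, by rw [← Algebra.smul_def]; exact hN.smul r⟩
  | add a b _ _ ha hb =>
    intro x hx
    obtain ⟨N, hN⟩ := ha x hx
    obtain ⟨M, hM⟩ := hb x hx
    refine ⟨max N M, ?_⟩
    rw [add_mul]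
    exact (hN.mono (le_max_left _ _)).add (hM.mono (le_max_right _ _))
  | mul a b _ _ ha hb =>
    intro x hx
    rw [mul_assoc]
    exact ha _ (hb _ hx)

/-- The alternative `s0 = 0` covers the case `N < deg u`, where the remaining formal degree does not
exist. -/
theorem decompose {N : ℕ} {s : FreeAlgebra F X} (h : Filt u v N s) :
    ∃ (c : F) (s0 s1 : FreeAlgebra F X), s = algebraMap F _ c + u * s0 + v * s1 ∧
      (s0 = 0 ∨ ∃ M, M + deg F X u = N ∧ Filt u v M s0) ∧
      (s1 = 0 ∨ ∃ M, M + deg F X v = N ∧ Filt u v M s1) := by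
  have key : ∀ {d N : ℕ} {s t : FreeAlgebra F X}, (s = 0 ∨ ∃ M, M + d = N ∧ Filt u v M s) →
      (t = 0 ∨ ∃ M, M + d = N ∧ Filt u v M t) →
      (s + t = 0 ∨ ∃ M, M + d = N ∧ Filt u v M (s + t)) := by
    rintro d N s t (rfl | ⟨M, hM, h⟩) (rfl | ⟨M', hM', h'⟩)
    · simp
    · exact .inr ⟨M', hM', by rwa [zero_add]⟩
    · exact .inr ⟨M, hM, by rwa [add_zero]⟩
    · obtain rfl : M = M' := by omega
      exact .inr ⟨M, hM, h.add h'⟩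
  induction h with
  | scalar _ c => exact ⟨c, 0, 0, by simp, .inl rfl, .inl rfl⟩
  | left h _ => exact ⟨0, _, 0, by simp, .inr ⟨_, rfl, h⟩, .inl rfl⟩
  | right h _ => exact ⟨0, 0, _, by simp, .inl rfl, .inr ⟨_, rfl, h⟩⟩
  | add _ _ h1 h2 =>
    obtain ⟨c, s0, s1, rfl, h3, h4⟩ := h1
    obtain ⟨c', s0', s1', rfl, h3', h4'⟩ := h2
    refine ⟨c + c', s0 + s0', s1 + s1', ?_, key h3 h3', key h4 h4'⟩
    simp only [map_add, mul_add]
    abel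

theorem bound {N : ℕ} {s : FreeAlgebra F X} (h : Filt u v N s) :
    deg F X s ≤ N ∧ (grade F X s).coeff N ∈ Algebra.adjoin F {top F X u, top F X v} := by
  induction h with
  | scalar N c =>
    rw [deg, grade_eq_monomial (algebraMap_mem_words c)]
    refine ⟨(natDegree_monomial_le _).trans (Nat.zero_le _), ?_⟩
    rw [coeff_monomial]
    split_ifs
    · exact Subalgebra.algebraMap_mem _ _
    · exact zero_mem _
  | @left N s _ ih =>
    rw [deg, map_mul, add_comm]
    refine ⟨natDegree_mul_le_of_le le_rfl ih.1, ?_⟩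
    rw [coeff_mul_add_eq_of_natDegree_le (df := deg F X _) le_rfl ih.1]
    exact mul_mem (Algebra.subset_adjoin (by simp [top, deg])) ih.2
  | @right N s _ ih =>
    rw [deg, map_mul, add_comm]
    refine ⟨natDegree_mul_le_of_le le_rfl ih.1, ?_⟩
    rw [coeff_mul_add_eq_of_natDegree_le (df := deg F X _) le_rfl ih.1]
    exact mul_mem (Algebra.subset_adjoin (by simp [top, deg])) ih.2
  | add _ _ h1 h2 =>
    rw [deg, map_add]
    exact ⟨natDegree_add_le_of_degree_le h1.1 h2.1, by rw [coeff_add]; exact add_mem h1.2 h2.2⟩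

/-- If the leading components satisfy no relation, nothing cancels in the top formal degree. A
vanishing coefficient there forces both cofactors of `u` and `v` to have vanishing top coefficients,
and induction lowers their formal degrees. -/
theorem lower (hu : 1 ≤ deg F X u) (hv : 1 ≤ deg F X v)
    (hind : ∀ x ∈ Algebra.adjoin F {top F X u, top F X v},
      ∀ y ∈ Algebra.adjoin F {top F X u, top F X v},
        top F X u * x + top F X v * y = 0 → x = 0 ∧ y = 0) {N : ℕ} {s : FreeAlgebra F X}
    (h : Filt u v (N + 1) s) (h0 : (grade F X s).coeff (N + 1) = 0) : Filt u v N s := by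
  induction N using Nat.strong_induction_on generalizing s with
  | _ N ih =>
    have piece : ∀ z : FreeAlgebra F X, 1 ≤ deg F X z →
        (∀ {M s}, Filt u v M s → Filt u v (M + deg F X z) (z * s)) → ∀ s0,
        (s0 = 0 ∨ ∃ M, M + deg F X z = N + 1 ∧ Filt u v M s0) →
        ∃ x ∈ Algebra.adjoin F {top F X u, top F X v},
          (grade F X (z * s0)).coeff (N + 1) = top F X z * x ∧ (x = 0 → Filt u v N (z * s0)) := by
      rintro z hz hmul s0 (rfl | ⟨M, hM, hs0⟩)
      · exact ⟨0, zero_mem _, by simp, fun _ => by rw [mul_zero]; exact zero N⟩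
      refine ⟨_, hs0.bound.2, ?_, fun hx => ?_⟩
      · rw [← hM, map_mul, add_comm, coeff_mul_add_eq_of_natDegree_le (df := deg F X z) le_rfl hs0.bound.1]
        rfl
      -- In formal degree `0` the cofactor is a scalar, and its vanishing coefficient is the scalar
      -- itself.
      · rcases M with _ | M
        · have h1 := mem_words_zero_of_deg (Nat.le_zero.1 hs0.bound.1)
          have h2 : s0 = 0 := by simpa [grade_eq_monomial h1] using hx
          rw [h2, mul_zero]
          exact zero N
        · have := hmul (ih M (by omega) hs0 hx)
          rwa [show M + deg F X z = N by omega] at this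
    obtain ⟨c, s0, s1, rfl, h3, h4⟩ := h.decompose
    obtain ⟨x, hx, hx1, hx2⟩ := piece u hu left s0 h3
    obtain ⟨y, hy, hy1, hy2⟩ := piece v hv right s1 h4
    rw [map_add, map_add, coeff_add, coeff_add, grade_eq_monomial (algebraMap_mem_words c),
      coeff_monomial, if_neg (by omega), zero_add, hx1, hy1] at h0
    obtain ⟨rfl, rfl⟩ := hind x hx y hy h0
    exact ((scalar N c).add (hx2 rfl)).add (hy2 rfl)

theorem of_deg_le (hu : 1 ≤ deg F X u) (hv : 1 ≤ deg F X v)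
    (hind : ∀ x ∈ Algebra.adjoin F {top F X u, top F X v},
      ∀ y ∈ Algebra.adjoin F {top F X u, top F X v},
        top F X u * x + top F X v * y = 0 → x = 0 ∧ y = 0) {N M : ℕ} {s : FreeAlgebra F X}
    (h : Filt u v N s) (hs : deg F X s ≤ M) : Filt u v M s := by
  induction N with
  | zero => exact h.mono (Nat.zero_le _)
  | succ N ih =>
    rcases Nat.lt_or_ge M (N + 1) with h1 | h1
    · exact ih (h.lower hu hv hind (coeff_eq_zero_of_natDegree_lt (hs.trans_lt h1)))
    · exact h.mono h1

end Filt

theorem deg_ι_le (x : X) : deg F X (ι F x) ≤ 1 := by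
  rw [deg, grade_ι]
  exact natDegree_monomial_le _

/-- Without a relation, formal degree can be lowered to actual degree, so every letter has formal
degree at most `1`. A generator of degree at least `2` cannot occur there. All letters would then be
affine expressions in the other generator, and would commute. -/
theorem top_dependent {u v : FreeAlgebra F X} (hu : 1 ≤ deg F X u) (hv : 1 ≤ deg F X v)
    (h : Algebra.adjoin F {u, v} = ⊤) {a b : X} (hab : ι F a * ι F b ≠ ι F b * ι F a)
    (h2 : 2 ≤ deg F X u ∨ 2 ≤ deg F X v) :
    ∃ x ∈ Algebra.adjoin F {top F X u, top F X v},
      ∃ y ∈ Algebra.adjoin F {top F X u, top F X v},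
        x ≠ 0 ∧ top F X u * x + top F X v * y = 0 := by
  by_contra! hcon
  have hv0 : top F X v ≠ 0 := top_ne_zero fun h => by simp [h, deg] at hv
  have hind : ∀ x ∈ Algebra.adjoin F {top F X u, top F X v},
      ∀ y ∈ Algebra.adjoin F {top F X u, top F X v},
        top F X u * x + top F X v * y = 0 → x = 0 ∧ y = 0 := by
    intro x hx y hy hxy
    by_cases hx0 : x = 0
    · subst hx0
      rw [mul_zero, zero_add] at hxy
      exact ⟨rfl, (mul_eq_zero.1 hxy).resolve_left hv0⟩
    · exact absurd hxy (hcon x hx y hy hx0)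
  have hone : ∀ (x : X), Filt u v 1 (ι F x) := fun x => by
    obtain ⟨N, hN⟩ := Filt.exists_of_mem_adjoin (u := u) (v := v) (s := ι F x)
      (h ▸ Algebra.mem_top)
    exact hN.of_deg_le hu hv hind (deg_ι_le x)
  have hscal : ∀ {s M d}, 1 ≤ d → M + d = 1 → Filt u v M s →
      ∃ c : F, s = algebraMap F _ c := by
    intro s M d hd hM hs
    obtain rfl : M = 0 := by omega
    exact mem_words_zero.1 (mem_words_zero_of_deg (Nat.le_zero.1 hs.bound.1))
  have hz : ∃ z : FreeAlgebra F X, ∀ x : X, ∃ c d : F, ι F x = algebraMap F _ c + d • z := by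
    rcases h2 with h2 | h2
    · refine ⟨v, fun x => ?_⟩
      obtain ⟨c, s0, s1, hs, h3, h4⟩ := (hone x).decompose
      obtain rfl : s0 = 0 := h3.resolve_right (by rintro ⟨M, hM, -⟩; omega)
      obtain ⟨d, rfl⟩ : ∃ d : F, s1 = algebraMap F _ d := by
        rcases h4 with rfl | ⟨M, hM, h4⟩
        · exact ⟨0, by simp⟩
        · exact hscal hv hM h4
      exact ⟨c, d, by rw [hs, mul_zero, add_zero, ← Algebra.commutes, Algebra.smul_def]⟩
    · refine ⟨u, fun x => ?_⟩
      obtain ⟨c, s0, s1, hs, h3, h4⟩ := (hone x).decompose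
      obtain rfl : s1 = 0 := h4.resolve_right (by rintro ⟨M, hM, -⟩; omega)
      obtain ⟨d, rfl⟩ : ∃ d : F, s0 = algebraMap F _ d := by
        rcases h3 with rfl | ⟨M, hM, h3⟩
        · exact ⟨0, by simp⟩
        · exact hscal hu hM h3
      exact ⟨c, d, by rw [hs, mul_zero, add_zero, ← Algebra.commutes, Algebra.smul_def]⟩
  obtain ⟨z, hz⟩ := hz
  obtain ⟨c, d, h5⟩ := hz a
  obtain ⟨c', d', h6⟩ := hz b
  apply hab
  have hc : Commute (algebraMap F (FreeAlgebra F X) c + d • z)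
      (algebraMap F (FreeAlgebra F X) c' + d' • z) :=
    (Algebra.commute_algebraMap_left _ _).add_left
      ((Algebra.commute_algebraMap_right _ _).add_right
        (((Commute.refl z).smul_left d).smul_right d'))
  rw [h5, h6]
  exact hc

end FreeAlgebra

/-! ### Powers of Lie elements -/

namespace MvPolynomial

variable {F : Type*} [Field F] {σ : Type*}

variable (F σ) in
/-- Polynomials of total degree less than `n`. -/
noncomputable def low (n : ℕ) : Submodule F (MvPolynomial σ F) := restrictSupport F {d | d.degree < n}

theorem mem_low {n : ℕ} {r : MvPolynomial σ F} :
    r ∈ low F σ n ↔ ∀ d, n ≤ d.degree → coeff d r = 0 := by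
  rw [low, mem_restrictSupport_iff]
  constructor
  · intro h d hd
    by_contra h0
    exact absurd (h (by simpa using h0)) (by simpa using hd)
  · intro h d hd
    by_contra h0
    exact (by simpa using hd : coeff d r ≠ 0) (h d (by simpa using h0))

theorem low_mono {m n : ℕ} (h : m ≤ n) : low F σ m ≤ low F σ n := fun _ hr =>
  mem_low.2 fun d hd => mem_low.1 hr d (h.trans hd)

theorem monomial_mem_low {n : ℕ} {d : σ →₀ ℕ} (h : d.degree < n) (c : F) :
    monomial d c ∈ low F σ n := by
  classical
  refine mem_low.2 fun e he => ?_
  rw [coeff_monomial, if_neg]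
  rintro rfl
  omega

theorem mul_mem_low {m n : ℕ} {r s : MvPolynomial σ F} (hr : r ∈ low F σ (m + 1))
    (hs : s ∈ low F σ n) : r * s ∈ low F σ (m + n) := by
  classical
  refine mem_low.2 fun d hd => ?_
  rw [coeff_mul]
  refine Finset.sum_eq_zero fun x hx => ?_
  have h : x.1.degree + x.2.degree = d.degree := by
    rw [← Finset.HasAntidiagonal.mem_antidiagonal.1 hx, map_add]
  rcases Nat.lt_or_ge m x.1.degree with h1 | h1
  · rw [mem_low.1 hr _ h1, zero_mul]
  · rw [mem_low.1 hs _ (by omega), mul_zero]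

theorem low_zero {r : MvPolynomial σ F} (hr : r ∈ low F σ 0) : r = 0 :=
  MvPolynomial.ext _ _ fun d => by rw [mem_low.1 hr d (Nat.zero_le _), coeff_zero]

theorem IsHomogeneous.mem_low {n : ℕ} {r : MvPolynomial σ F} (hr : r.IsHomogeneous n) :
    r ∈ low F σ (n + 1) :=
  MvPolynomial.mem_low.2 fun _ hd => hr.coeff_eq_zero (by omega)

theorem IsHomogeneous.eq_zero_of_mem_low {n : ℕ} {r : MvPolynomial σ F} (hr : r.IsHomogeneous n)
    (h : r ∈ low F σ n) : r = 0 := by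
  ext d
  rw [coeff_zero]
  by_cases hd : d.degree = n
  · exact MvPolynomial.mem_low.1 h d hd.ge
  · exact hr.coeff_eq_zero hd

theorem low_induction {n : ℕ} {P : MvPolynomial σ F → Prop} (h0 : P 0)
    (hadd : ∀ r s, P r → P s → P (r + s)) (hm : ∀ d c, d.degree < n → P (monomial d c))
    {r : MvPolynomial σ F} (hr : r ∈ low F σ n) : P r := by
  rw [as_sum r]
  refine Finset.sum_induction _ P hadd h0 fun d hd => hm d _ ?_
  by_contra h
  exact mem_support_iff.1 hd (mem_low.1 hr d (not_lt.1 h))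

theorem monomial_cases (d : σ →₀ ℕ) (c : F) :
    (d = 0) ∨ ∃ i e, d.degree = e.degree + 1 ∧ monomial d c = X i * monomial e c := by
  classical
  by_cases h : d = 0
  · exact .inl h
  · obtain ⟨i, hi⟩ : ∃ i, d i ≠ 0 := by
      by_contra! hi
      exact h (Finsupp.ext hi)
    have h1 : Finsupp.single i 1 + (d - Finsupp.single i 1) = d :=
      add_tsub_cancel_of_le (Finsupp.single_le_iff.2 (Nat.one_le_iff_ne_zero.2 hi))
    refine .inr ⟨i, d - Finsupp.single i 1, ?_, ?_⟩
    · nth_rw 1 [← h1]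
      rw [map_add, Finsupp.degree_single, add_comm]
    · rw [X, monomial_mul, one_mul, h1]

/-- `low F σ 2` is the space of polynomials of degree at most `1`. By the Leibniz rule, a derivation
sending the variables there never raises the degree. -/
theorem derivation_mem_low (D : Derivation F (MvPolynomial σ F) (MvPolynomial σ F))
    (hD : ∀ i, D (X i) ∈ low F σ 2) {n : ℕ} {r : MvPolynomial σ F} (hr : r ∈ low F σ n) :
    D r ∈ low F σ n := by
  induction n generalizing r with
  | zero => rw [low_zero hr, map_zero]; exact zero_mem _
  | succ n ih =>
    refine low_induction (P := fun r => D r ∈ low F σ (n + 1)) (by simp)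
      (fun r s hr hs => by rw [map_add]; exact add_mem hr hs) (fun d c hd => ?_) hr
    rcases monomial_cases d c with rfl | ⟨i, e, he, h⟩
    · have : D (monomial 0 c) = 0 := derivation_C D c
      rw [this]
      exact zero_mem _
    · have h1 : monomial e c ∈ low F σ n := monomial_mem_low (by omega) c
      rw [h, Derivation.leibniz, smul_eq_mul, smul_eq_mul, add_comm n 1]
      refine add_mem (mul_mem_low (isHomogeneous_X F i).mem_low (ih h1)) ?_
      rw [mul_comm]
      exact mul_mem_low (hD i) h1

end MvPolynomial

/-! ### A Poincaré–Birkhoff–Witt type action on polynomials in words -/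

namespace FreeAlgebra

open MvPolynomial

variable {F : Type*} [Field F] {X : Type*}

/-- Elements obtained from the free generators by linear operations and commutators. -/
inductive IsLie : FreeAlgebra F X → Prop
  | of (x : X) : IsLie (ι F x)
  | smul (c : F) {f : FreeAlgebra F X} : IsLie f → IsLie (c • f)
  | add {f g : FreeAlgebra F X} : IsLie f → IsLie g → IsLie (f + g)
  | comm {f g : FreeAlgebra F X} : IsLie f → IsLie g → IsLie (f * g - g * f)

variable (F X) in
/-- Polynomials in the words in `X`. -/
abbrev WordPoly := MvPolynomial (FreeMonoid X) F

variable (F X) in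
/-- The identification of the free algebra with the linear polynomials in the words. -/
noncomputable def lin : FreeAlgebra F X →ₗ[F] WordPoly F X :=
  (basisFreeMonoid F X).constr F fun m => MvPolynomial.X m

@[simp]
theorem lin_basis (m : FreeMonoid X) :
    lin F X (basisFreeMonoid F X m) = MvPolynomial.X m :=
  Module.Basis.constr_basis _ _ _ _

theorem lin_isHomogeneous (f : FreeAlgebra F X) : (lin F X f).IsHomogeneous 1 := by
  rw [← mem_homogeneousSubmodule, ← (basisFreeMonoid F X).linearCombination_repr f,
    Finsupp.linearCombination_apply, Finsupp.sum, map_sum]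
  refine sum_mem fun m _ => ?_
  rw [map_smul, lin_basis]
  exact Submodule.smul_mem _ _ (isHomogeneous_X F m)

theorem lin_injective : Function.Injective (lin F X) := by
  refine (injective_iff_map_eq_zero _).2 fun f hf => (basisFreeMonoid F X).ext_elem fun m => ?_
  have : lcoeff F (Finsupp.single m 1) ∘ₗ lin F X = (basisFreeMonoid F X).coord m := by
    classical
    refine (basisFreeMonoid F X).ext fun n => ?_
    simp [coeff_X, Finsupp.single_apply, Finsupp.single_left_inj]
  have h := LinearMap.congr_fun this f
  simp only [LinearMap.comp_apply, hf, map_zero, Module.Basis.coord_apply] at h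
  rw [← h]
  simp

/-- The derivation of the word polynomials extending a linear endomorphism of the free algebra. -/
noncomputable def extend (φ : Module.End F (FreeAlgebra F X)) :
    Derivation F (WordPoly F X) (WordPoly F X) :=
  mkDerivation F fun m => lin F X (φ (basisFreeMonoid F X m))

theorem extend_lin (φ : Module.End F (FreeAlgebra F X)) (f : FreeAlgebra F X) :
    extend φ (lin F X f) = lin F X (φ f) := by
  have : (extend φ).toLinearMap ∘ₗ lin F X = lin F X ∘ₗ φ :=
    (basisFreeMonoid F X).ext fun m => by simp [extend]
  exact LinearMap.congr_fun this f

theorem extend_mul_sub (φ ψ : Module.End F (FreeAlgebra F X)) :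
    extend (φ * ψ - ψ * φ) = ⁅extend φ, extend ψ⁆ := by
  refine derivation_ext fun m => ?_
  rw [Derivation.commutator_apply, ← lin_basis]
  simp only [extend_lin, LinearMap.sub_apply, map_sub, Module.End.mul_apply]

theorem extend_mem_low (φ : Module.End F (FreeAlgebra F X)) {n : ℕ} {r : WordPoly F X}
    (hr : r ∈ low F _ n) : extend φ r ∈ low F _ n := by
  refine derivation_mem_low _ (fun m => ?_) hr
  rw [← lin_basis, extend_lin]
  exact (lin_isHomogeneous _).mem_low

variable (F X) in
/-- The action of the free algebra on the word polynomials in which a generator `x` acts as the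
sum of the derivation extending left multiplication by `x` and the multiplication by `x`. -/
noncomputable def act : FreeAlgebra F X →ₐ[F] Module.End F (WordPoly F X) :=
  lift F fun x => (extend (LinearMap.mulLeft F (ι F x))).toLinearMap +
    LinearMap.mulLeft F (lin F X (ι F x))

/-- Operators of the form derivation plus multiplication are closed under commutators: writing `D_f`
for the extension of left multiplication by `f`, the multiplication part of the commutator is `D_f g
- D_g f = f g - g f`. Applied to `1`, a Lie element therefore gives a linear polynomial. -/
theorem IsLie.act_apply {f : FreeAlgebra F X} (hf : IsLie f) (r : WordPoly F X) :
    act F X f r = extend (LinearMap.mulLeft F f) r + lin F X f * r := by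
  induction hf generalizing r with
  | of x => simp [act]
  | @smul c f hf ih =>
    have : extend (LinearMap.mulLeft F (c • f)) = c • extend (LinearMap.mulLeft F f) :=
      derivation_ext fun m => by simp [extend]
    simp [ih, this]
  | @add f g hf hg h1 h2 =>
    have : extend (LinearMap.mulLeft F (f + g)) =
        extend (LinearMap.mulLeft F f) + extend (LinearMap.mulLeft F g) :=
      derivation_ext fun m => by simp [extend, add_mul]
    simp only [map_add, LinearMap.add_apply, h1, h2, this, Derivation.add_apply]
    ring
  | @comm f g hf hg h1 h2 =>
    have h : LinearMap.mulLeft F (f * g - g * f) =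
        LinearMap.mulLeft F f * LinearMap.mulLeft F g -
          LinearMap.mulLeft F g * LinearMap.mulLeft F f := by
      ext x
      simp [sub_mul, mul_assoc]
    rw [h, extend_mul_sub, Derivation.commutator_apply]
    simp only [map_sub, map_mul, LinearMap.sub_apply, Module.End.mul_apply, h1, h2, map_add,
      Derivation.leibniz, extend_lin, LinearMap.mulLeft_apply, smul_eq_mul]
    ring

/-- The operators `r ↦ y r + E r`, with `E` extending the right multiplication by `y`, commute
with the action. -/
theorem act_comm (t y : FreeAlgebra F X) (r : WordPoly F X) :
    act F X t (lin F X y * r + extend (LinearMap.mulRight F y) r) =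
      lin F X y * act F X t r + extend (LinearMap.mulRight F y) (act F X t r) := by
  induction t using FreeAlgebra.induction generalizing r with
  | grade0 c =>
    simp only [AlgHom.commutes, Module.algebraMap_end_apply, Derivation.map_smul, smul_add,
      mul_smul_comm]
  | grade1 x =>
    have h : ⁅extend (LinearMap.mulLeft F (ι F x)), extend (LinearMap.mulRight F y)⁆ r = 0 := by
      rw [← extend_mul_sub, sub_eq_zero.2]
      · have : extend (0 : Module.End F (FreeAlgebra F X)) = 0 :=
          derivation_ext fun m => by simp [extend]
        rw [this, Derivation.zero_apply]
      · ext z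
        simp [mul_assoc]
    rw [Derivation.commutator_apply, sub_eq_zero] at h
    simp only [(IsLie.of x).act_apply, map_add, Derivation.leibniz, extend_lin,
      LinearMap.mulLeft_apply, LinearMap.mulRight_apply, smul_eq_mul, h]
    ring
  | mul s t hs ht => rw [map_mul, Module.End.mul_apply, ht, hs, Module.End.mul_apply]
  | add s t hs ht =>
    simp only [map_add, LinearMap.add_apply] at hs ht ⊢
    rw [add_add_add_comm, hs, ht, mul_add]
    abel

/-- Modulo lower degree, `t` acts as multiplication by the leading part `h` of its value at `1`. The
operators of `act_comm` commute with the action and differ from multiplication by a variable by a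
derivation that does not raise the degree. So the claim passes from `s` to `X i * s`. -/
theorem act_sub_mem_low {t : FreeAlgebra F X} {m : ℕ} {h : WordPoly F X}
    (hm : h ∈ low F _ (m + 1)) (ht : act F X t 1 - h ∈ low F _ m) {k : ℕ} {r : WordPoly F X}
    (hr : r ∈ low F _ (k + 1)) : act F X t r - h * r ∈ low F _ (m + k) := by
  induction k generalizing r with
  | zero =>
    refine low_induction (P := fun r => act F X t r - h * r ∈ low F _ (m + 0)) (by simp)
      (fun r s hr hs => ?_) (fun d c hd => ?_) hr
    · rw [map_add, mul_add, add_sub_add_comm]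
      exact add_mem hr hs
    · rcases monomial_cases d c with rfl | ⟨i, e, he, -⟩
      · have h1 : (monomial 0 c : WordPoly F X) = c • 1 := by
          rw [smul_eq_C_mul, mul_one]
          rfl
        rw [h1, map_smul, mul_smul_comm, mul_one, ← smul_sub]
        exact Submodule.smul_mem _ _ ht
      · omega
  | succ k ih =>
    refine low_induction (P := fun r => act F X t r - h * r ∈ low F _ (m + (k + 1))) (by simp)
      (fun r s hr hs => ?_) (fun d c hd => ?_) hr
    · rw [map_add, mul_add, add_sub_add_comm]
      exact add_mem hr hs
    · rcases monomial_cases d c with rfl | ⟨i, e, he, h0⟩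
      · exact low_mono (by omega) (ih (monomial_mem_low (by simp) c))
      · rw [h0]
        set s : WordPoly F X := monomial e c
        have hs : s ∈ low F _ (k + 1) := monomial_mem_low (by omega) c
        set y := basisFreeMonoid F X i
        have h2 := act_comm t y s
        have hE : extend (LinearMap.mulRight F y) s ∈ low F _ (k + 1) := extend_mem_low _ hs
        have hact : ∀ {q : WordPoly F X}, q ∈ low F _ (k + 1) →
            act F X t q ∈ low F _ (m + (k + 1)) := fun {q} hq => by
          rw [← sub_add_cancel (act F X t q) (h * q)]
          exact add_mem (low_mono (by omega) (ih hq)) (mul_mem_low hm hq)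
        rw [map_add, lin_basis] at h2
        have h3 : act F X t (MvPolynomial.X i * s) - h * (MvPolynomial.X i * s) =
            MvPolynomial.X i * (act F X t s - h * s) +
              extend (LinearMap.mulRight F y) (act F X t s) -
              act F X t (extend (LinearMap.mulRight F y) s) := by
          rw [eq_sub_of_add_eq h2]
          ring
        rw [h3]
        refine sub_mem (add_mem ?_ (extend_mem_low _ (hact hs))) (hact hE)
        rw [show m + (k + 1) = 1 + (m + k) by ring]
        exact mul_mem_low (isHomogeneous_X F i).mem_low (ih hs)

theorem act_pow_sub_mem_low {t : FreeAlgebra F X} {m : ℕ} {h : WordPoly F X}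
    (hm : h.IsHomogeneous m) (ht : act F X t 1 - h ∈ low F _ m) (i : ℕ) :
    act F X (t ^ i) 1 - h ^ i ∈ low F _ (m * i) := by
  induction i with
  | zero => simp
  | succ i ih =>
    have h1 : act F X (t ^ i) 1 ∈ low F _ (m * i + 1) := by
      rw [← sub_add_cancel (act F X (t ^ i) 1) (h ^ i)]
      exact add_mem (low_mono (by omega) ih) (hm.pow i).mem_low
    rw [pow_succ', map_mul, Module.End.mul_apply, pow_succ', mul_add, mul_one, add_comm]
    rw [← sub_add_sub_cancel _ (h * act F X (t ^ i) 1), ← mul_sub]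
    exact add_mem (act_sub_mem_low hm.mem_low ht h1) (mul_mem_low hm.mem_low ih)

theorem IsLie.act_one {f : FreeAlgebra F X} (hf : IsLie f) : act F X f 1 = lin F X f := by
  rw [hf.act_apply, Derivation.map_one_eq_zero, zero_add, mul_one]

theorem lin_ne_zero {f : FreeAlgebra F X} (hf : f ≠ 0) : lin F X f ≠ 0 :=
  fun h => hf (lin_injective (by rw [h, map_zero]))

/-- A nonzero Lie element is not a proper power. -/
theorem IsLie.eq_one_of_eq_pow {f t : FreeAlgebra F X} (hf : IsLie f) (hf0 : f ≠ 0) {i : ℕ}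
    (hi : 1 ≤ i) (h : t ^ i = f) : i = 1 := by
  set r := act F X t 1 with hr
  have hlin := lin_isHomogeneous f
  have hlin0 := lin_ne_zero hf0
  have h1 : r ≠ 0 := by
    intro h0
    -- `low F _ 0` is zero, so taking `h = 0` in degree `0` says that `t ^ i` kills `1`.
    have h2 := act_pow_sub_mem_low (isHomogeneous_zero _ _ 0) (t := t) (by simp [← hr, h0]) i
    rw [zero_mul] at h2
    replace h2 := low_zero h2
    rw [h, hf.act_one, zero_pow (by omega), sub_zero] at h2
    exact hlin0 h2
  set m := r.totalDegree
  set c := homogeneousComponent m r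
  have hc : c.IsHomogeneous m := homogeneousComponent_isHomogeneous m r
  have hrc : r - c ∈ low F _ m := by
    refine mem_low.2 fun d hd => ?_
    rw [coeff_sub, coeff_homogeneousComponent]
    split_ifs with h3
    · exact sub_self _
    · rw [sub_zero]
      refine coeff_eq_zero_of_totalDegree_lt ?_
      change m < d.degree
      omega
  have hc0 : c ≠ 0 := by
    intro h0
    rw [h0, sub_zero] at hrc
    obtain ⟨d, hd, hdm⟩ := Finset.exists_mem_eq_sup _ (support_nonempty.2 h1)
      fun s => s.sum fun _ e => e
    exact mem_support_iff.1 hd (mem_low.1 hrc d hdm.le)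
  have h2 := act_pow_sub_mem_low hc hrc i
  rw [h, hf.act_one] at h2
  by_contra hi1
  have hci := hc.pow i
  -- The leading part `c ^ i` has degree `m * i`, whereas `lin F X f` has degree `1`. These differ
  -- both for `m = 0` and for `m ≥ 1`, `i ≥ 2`.
  rcases Nat.eq_zero_or_pos m with hm | hm
  · rw [hm, zero_mul] at h2 hci
    have h3 := sub_eq_zero.1 (low_zero h2)
    exact absurd (hlin.inj_right (h3 ▸ hci) hlin0) one_ne_zero
  · have h4 : 2 ≤ m * i := le_trans (by omega) (Nat.le_mul_of_pos_left i hm)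
    have h3 : c ^ i ∈ low F _ (m * i) := by
      rw [← sub_sub_cancel (lin F X f) (c ^ i)]
      exact sub_mem (low_mono h4 hlin.mem_low) h2
    exact pow_ne_zero i hc0 (hci.eq_zero_of_mem_low h3)

/-- Applied to `1`, the `i`-th power of a nonzero Lie element has degree exactly `i`. The term `f`
contributes only degree `1`, so the two sides have degrees `m` and `n`. -/
theorem IsLie.pow_eq_of_add_smul_pow {f g h : FreeAlgebra F X} (hf : IsLie f) (hg : IsLie g)
    (hh : IsLie h) (hg0 : g ≠ 0) (hh0 : h ≠ 0) {m n : ℕ} (hm : 2 ≤ m) (hn : 2 ≤ n) {α β : F}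
    (hα : α ≠ 0) (hβ : β ≠ 0) (heq : f + α • g ^ m = β • h ^ n) : m = n := by
  have key : ∀ {z : FreeAlgebra F X}, IsLie z → ∀ i,
      act F X (z ^ i) 1 - lin F X z ^ i ∈ low F _ i := fun {z} hz i => by
    simpa using act_pow_sub_mem_low (lin_isHomogeneous z) (by simp [hz.act_one]) i
  have hpow : ∀ {z : FreeAlgebra F X} (i : ℕ), (lin F X z ^ i).IsHomogeneous i := fun {z} i => by
    simpa using (lin_isHomogeneous z).pow i
  have hact : ∀ {z : FreeAlgebra F X}, IsLie z → ∀ {i j}, i < j →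
      act F X (z ^ i) 1 ∈ low F _ j := fun {z} hz i j hij => by
    rw [← sub_add_cancel (act F X (z ^ i) 1) (lin F X z ^ i)]
    exact add_mem (low_mono hij.le (key hz i)) (low_mono hij (hpow i).mem_low)
  have heq' := congrArg (fun z => act F X z 1) heq
  simp only [map_add, map_smul, LinearMap.add_apply, LinearMap.smul_apply, hf.act_one] at heq'
  have hfl : ∀ {j}, 2 ≤ j → lin F X f ∈ low F _ j := fun hj =>
    low_mono hj (lin_isHomogeneous f).mem_low
  have hfin : ∀ {z : FreeAlgebra F X}, IsLie z → z ≠ 0 → ∀ {i} {γ : F}, γ ≠ 0 →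
      γ • act F X (z ^ i) 1 ∉ low F _ i := fun {z} hz hz0 {i} {γ} hγ hmem => by
    rw [Submodule.smul_mem_iff _ hγ] at hmem
    have := sub_mem hmem (key hz i)
    rw [sub_sub_cancel] at this
    exact pow_ne_zero i (lin_ne_zero hz0) ((hpow i).eq_zero_of_mem_low this)
  rcases lt_trichotomy m n with hmn | hmn | hmn
  · refine absurd ?_ (hfin hh hh0 hβ (i := n))
    rw [← heq']
    exact add_mem (hfl hn) (Submodule.smul_mem _ _ (hact hg hmn))
  · exact hmn
  · refine absurd ?_ (hfin hg hg0 hα (i := m))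
    rw [eq_sub_of_add_eq' heq']
    exact sub_mem (Submodule.smul_mem _ _ (hact hh hmn)) (hfl hm)

end FreeAlgebra

/-! ### Pairs of elements which do not generate the free algebra -/

namespace FreeAlgebra

open Polynomial

section General

variable {F : Type*} [Field F] {X : Type*}

theorem IsLie.zero (x : X) : IsLie (0 : FreeAlgebra F X) := by
  rw [← zero_smul F (ι F x)]
  exact (IsLie.of x).smul 0

theorem IsLie.neg {f : FreeAlgebra F X} (hf : IsLie f) : IsLie (-f) := by
  rw [← neg_one_smul F f]
  exact hf.smul _

theorem IsLie.sub {f g : FreeAlgebra F X} (hf : IsLie f) (hg : IsLie g) : IsLie (f - g) := by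
  rw [sub_eq_add_neg]
  exact hf.add hg.neg

theorem IsLie.coeff_grade {f : FreeAlgebra F X} (hf : IsLie f) (n : ℕ) :
    IsLie ((grade F X f).coeff n) := by
  induction hf generalizing n with
  | of x =>
    rw [grade_ι, coeff_monomial]
    split_ifs
    · exact .of x
    · exact .zero x
  | smul c _ ih =>
    rw [map_smul, coeff_smul]
    exact (ih n).smul c
  | add _ _ h1 h2 =>
    rw [map_add, coeff_add]
    exact (h1 n).add (h2 n)
  | @comm f g hf hg h1 h2 =>
    rw [map_sub, map_mul, map_mul, coeff_sub, coeff_mul, coeff_mul,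
      ← Finset.Nat.sum_antidiagonal_swap (f := fun x : ℕ × ℕ =>
        (grade F X g).coeff x.1 * (grade F X f).coeff x.2), ← Finset.sum_sub_distrib]
    refine Finset.sum_induction _ IsLie (fun _ _ => .add) ?_ fun x _ => (h1 _).comm (h2 _)
    -- `IsLie.zero` asks for a letter; `f - f` does not.
    have := hf.sub hf
    rwa [sub_self] at this

variable {R A B : Type*} [CommRing R] [Ring A] [Ring B] [Algebra R A] [Algebra R B]

/-- The image of `ρ` is generated by the single element `ρ u`. -/
theorem commute_of_adjoin_eq_top {u v : A} (h : Algebra.adjoin R {u, v} = ⊤) (ρ : A →ₐ[R] B)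
    (hv : ρ v = 0) (x y : A) : Commute (ρ x) (ρ y) := by
  have key : ∀ z : B, Commute (ρ u) z → ∀ x : A, Commute (ρ x) z := fun z hz x => by
    have hx : x ∈ Algebra.adjoin R {u, v} := h ▸ Algebra.mem_top
    induction hx using Algebra.adjoin_induction with
    | mem y hy =>
      rcases hy with rfl | rfl
      · exact hz
      · rw [hv]
        exact Commute.zero_left z
    | algebraMap r =>
      rw [AlgHom.commutes]
      exact Algebra.commute_algebraMap_left r z
    | add a b _ _ ha hb =>
      rw [map_add]
      exact ha.add_left hb
    | mul a b _ _ ha hb =>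
      rw [map_mul]
      exact ha.mul_left hb
  exact key _ (key _ (Commute.refl _) y).symm x

theorem exists_algebraMap_of_adjoin_eq_top {u v : A} (h : Algebra.adjoin R {u, v} = ⊤)
    (ρ : A →ₐ[R] B) (hu : ρ u = 0) (hv : ρ v = 0) (x : A) : ∃ c : R, ρ x = algebraMap R B c := by
  have hx : x ∈ Algebra.adjoin R {u, v} := h ▸ Algebra.mem_top
  induction hx using Algebra.adjoin_induction with
  | mem y hy =>
    rcases hy with rfl | rfl
    · exact ⟨0, by rw [hu, map_zero]⟩
    · exact ⟨0, by rw [hv, map_zero]⟩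
  | algebraMap r => exact ⟨r, AlgHom.commutes _ _⟩
  | add a b _ _ ha hb =>
    obtain ⟨c, hc⟩ := ha
    obtain ⟨d, hd⟩ := hb
    exact ⟨c + d, by rw [map_add, map_add, hc, hd]⟩
  | mul a b _ _ ha hb =>
    obtain ⟨c, hc⟩ := ha
    obtain ⟨d, hd⟩ := hb
    exact ⟨c * d, by rw [map_mul, map_mul, hc, hd]⟩

end General

/-! ### Twisted elements of the free algebra on two letters -/

variable {F : Type*} [Field F]

variable (F) in
/-- The commutator `b a - a b` of the two free generators. -/
noncomputable def bracket : FreeAlgebra F (Fin 2) := ι F 1 * ι F 0 - ι F 0 * ι F 1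

theorem isLie_bracket : IsLie (bracket F) := (IsLie.of 1).comm (.of 0)

variable (F) in
/-- The representation killing `s b - [b, a]`. -/
noncomputable def borel (s : F) : FreeAlgebra F (Fin 2) →ₐ[F] Matrix (Fin 2) (Fin 2) F :=
  lift F ![!![s, 0; 0, 0], !![0, 1; 0, 0]]

theorem borel_bracket (s : F) : borel F s (bracket F) = -s • borel F s (ι F 1) := by
  ext i j
  fin_cases i <;> fin_cases j <;> simp [borel, bracket]

theorem borel_not_commute {s : F} (hs : s ≠ 0) :
    ¬ Commute (borel F s (ι F 0)) (borel F s (ι F 1)) := by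
  intro h
  have := congrFun (congrFun h 0) 1
  simp [borel, Matrix.mul_apply, hs] at this

theorem ι_not_commute : ι F (0 : Fin 2) * ι F 1 ≠ ι F 1 * ι F 0 := fun h =>
  borel_not_commute one_ne_zero ((show Commute (ι F (0 : Fin 2)) (ι F 1) from h).map (borel F 1))

theorem bracket_ne_zero : bracket F ≠ 0 := fun h => ι_not_commute (sub_eq_zero.1 h).symm

theorem bracket_mem_words : bracket F ∈ words F (Fin 2) 2 :=
  sub_mem (mul_mem_words (ι_mem_words _) (ι_mem_words _))
    (mul_mem_words (ι_mem_words _) (ι_mem_words _))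

theorem grade_bracket_pow (p : ℕ) :
    grade F (Fin 2) (bracket F ^ p) = monomial (2 * p) (bracket F ^ p) := by
  rw [map_pow, grade_eq_monomial bracket_mem_words, monomial_pow]

theorem map_bracket (ρ : FreeAlgebra F (Fin 2) →ₐ[F] F[X]) : ρ (bracket F) = 0 := by
  rw [bracket, map_sub, map_mul, map_mul, mul_comm, sub_self]

/-- The components of low degree of a Lie element. -/
theorem IsLie.exists_coeff {f : FreeAlgebra F (Fin 2)} (hf : IsLie f) :
    ∃ α β γ : F, (grade F _ f).coeff 0 = 0 ∧ (grade F _ f).coeff 1 = α • ι F 0 + β • ι F 1 ∧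
      (grade F _ f).coeff 2 = γ • bracket F ∧
      ∀ ρ : FreeAlgebra F (Fin 2) →ₐ[F] F[X], ρ f = α • ρ (ι F 0) + β • ρ (ι F 1) := by
  induction hf with
  | of x =>
    fin_cases x
    · exact ⟨1, 0, 0, by simp [coeff_monomial], by simp, by simp [coeff_monomial], by simp⟩
    · exact ⟨0, 1, 0, by simp [coeff_monomial], by simp, by simp [coeff_monomial], by simp⟩
  | smul c _ ih =>
    obtain ⟨α, β, γ, h0, h1, h2, h3⟩ := ih
    exact ⟨c * α, c * β, c * γ, by simp [h0], by simp [h1, mul_smul], by simp [h2, mul_smul],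
      fun ρ => by rw [map_smul, h3, smul_add, mul_smul, mul_smul]⟩
  | add _ _ ih ih' =>
    obtain ⟨α, β, γ, h0, h1, h2, h3⟩ := ih
    obtain ⟨α', β', γ', h0', h1', h2', h3'⟩ := ih'
    refine ⟨α + α', β + β', γ + γ', by simp [h0, h0'], ?_, by simp [h2, h2', add_smul],
      fun ρ => ?_⟩
    · rw [map_add, coeff_add, h1, h1', add_smul, add_smul, add_add_add_comm]
    · rw [map_add, h3, h3', add_smul, add_smul, add_add_add_comm]
  | comm _ _ ih ih' =>
    obtain ⟨α, β, γ, h0, h1, h2, h3⟩ := ih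
    obtain ⟨α', β', γ', h0', h1', h2', h3'⟩ := ih'
    refine ⟨0, 0, β * α' - α * β', ?_, ?_, ?_, fun ρ => ?_⟩
    · simp [coeff_mul, h0, h0']
    · simp [coeff_mul, Finset.Nat.antidiagonal_succ, h0, h0']
    · simp only [map_sub, map_mul, coeff_sub, coeff_mul, Finset.Nat.antidiagonal_succ,
        Finset.Nat.antidiagonal_zero, Finset.map_singleton, Finset.sum_cons, Finset.map_cons,
        Finset.sum_singleton, Function.Embedding.prodMap, Function.Embedding.coeFn_mk, Prod.map,
        Function.Embedding.refl_apply, Nat.succ_eq_add_one, zero_add, Nat.reduceAdd, h0, h1, h0',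
        h1', zero_mul, mul_zero, add_zero, bracket, mul_add, add_mul, smul_mul_smul_comm,
        sub_smul, smul_sub]
      rw [mul_comm α' α, mul_comm β' β, mul_comm α' β, mul_comm β' α]
      abel
    · rw [map_sub, map_mul, map_mul, mul_comm, sub_self]
      simp

variable (F) in
/-- The homomorphism to the polynomial ring with `b ↦ 0`. -/
noncomputable def toPoly : FreeAlgebra F (Fin 2) →ₐ[F] F[X] := lift F ![Polynomial.X, 0]

/-- Elements of the Lie algebra generated by `a + [b, a] ^ p`, `b` and `[b, a]`, in a form which
shows their homogeneous components. -/
def IsTwisted (p : ℕ) (u : FreeAlgebra F (Fin 2)) : Prop :=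
  ∃ (f : FreeAlgebra F (Fin 2)) (c : F), IsLie f ∧ toPoly F f = c • Polynomial.X ∧
    u = f + c • bracket F ^ p

theorem IsTwisted.add {p : ℕ} {u v : FreeAlgebra F (Fin 2)} (hu : IsTwisted p u)
    (hv : IsTwisted p v) : IsTwisted p (u + v) := by
  obtain ⟨f, c, hf, hfc, rfl⟩ := hu
  obtain ⟨g, d, hg, hgd, rfl⟩ := hv
  exact ⟨f + g, c + d, hf.add hg, by rw [map_add, hfc, hgd, add_smul], by rw [add_smul]; abel⟩

theorem IsTwisted.smul {p : ℕ} {u : FreeAlgebra F (Fin 2)} (hu : IsTwisted p u) (r : F) :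
    IsTwisted p (r • u) := by
  obtain ⟨f, c, hf, hfc, rfl⟩ := hu
  exact ⟨r • f, r * c, hf.smul r, by rw [map_smul, hfc, mul_smul], by rw [smul_add, mul_smul]⟩

/-- Otherwise `bracket F ^ p` would be a Lie element and a proper power. -/
theorem bracket_pow_add_ne_zero {p : ℕ} (hp : 2 ≤ p) {f : FreeAlgebra F (Fin 2)} (hf : IsLie f)
    {c : F} (hc : c ≠ 0) : f + c • bracket F ^ p ≠ 0 := by
  intro h
  have h1 : bracket F ^ p = -(c⁻¹ • f) := by
    rw [eq_neg_of_add_eq_zero_left h, smul_neg, neg_neg, smul_smul, inv_mul_cancel₀ hc, one_smul]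
  have := (hf.smul c⁻¹).neg.eq_one_of_eq_pow (by rw [← h1]; exact pow_ne_zero _ bracket_ne_zero)
    (by omega) h1
  omega

theorem coeff_grade_twisted (p n : ℕ) (f : FreeAlgebra F (Fin 2)) (c : F) :
    (grade F _ (f + c • bracket F ^ p)).coeff n =
      (grade F _ f).coeff n + if 2 * p = n then c • bracket F ^ p else 0 := by
  rw [map_add, map_smul, grade_bracket_pow, coeff_add, coeff_smul, coeff_monomial, smul_ite,
    smul_zero]

/-- Since `i ≥ 2`, the leading component of `u` is not Lie, so it contains `c • bracket F ^ p` and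
`deg u = 2 * p`. As `deg v` is smaller, `v` has no such term and is Lie, whence `j = 1`. Comparing
powers gives `i = p`, hence `r = 2 = deg v`, and `v` can be written down explicitly. -/
theorem false_of_top_eq_pow {p : ℕ} (hp : 2 ≤ p) {u v : FreeAlgebra F (Fin 2)}
    (hu : IsTwisted p u) (hv : IsTwisted p v) (h : Algebra.adjoin F {u, v} = ⊤) (hu0 : u ≠ 0)
    (hv0 : v ≠ 0) {t : FreeAlgebra F (Fin 2)} {r i j : ℕ} {α β : F} (hj : 1 ≤ j) (hij : j < i)
    (hα : top F _ u = α • t ^ i) (hβ : top F _ v = β • t ^ j) (hi' : deg F _ u = i * r)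
    (hj' : deg F _ v = j * r) (hdeg : 1 ≤ deg F _ v) : False := by
  obtain ⟨f, c, hf, hfc, hfu⟩ := hu
  obtain ⟨g, d, hg, hgd, hgv⟩ := hv
  have htu := top_ne_zero hu0
  have htv := top_ne_zero hv0
  have hα0 : α ≠ 0 := by rintro rfl; exact htu (by rw [hα, zero_smul])
  have hβ0 : β ≠ 0 := by rintro rfl; exact htv (by rw [hβ, zero_smul])
  have hlie : ∀ {z s : FreeAlgebra F (Fin 2)} {γ : F} {k : ℕ}, IsLie z → z ≠ 0 → 1 ≤ k →
      γ ≠ 0 → z = γ • s ^ k → k = 1 := fun {z s γ k} hz hz0 hk hγ hzs =>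
    (hz.smul γ⁻¹).eq_one_of_eq_pow (smul_ne_zero (inv_ne_zero hγ) hz0) hk (t := s)
      (by rw [hzs, smul_smul, inv_mul_cancel₀ hγ, one_smul])
  have htop_u : top F _ u = (grade F _ f).coeff (deg F _ u) +
      if 2 * p = deg F _ u then c • bracket F ^ p else 0 := by
    rw [← coeff_grade_twisted, ← hfu]
    rfl
  have hu2 : 2 * p = deg F _ u ∧ c ≠ 0 := by
    by_contra hcon
    have h1 : top F _ u = (grade F _ f).coeff (deg F _ u) := by
      rw [htop_u, add_eq_left]
      split_ifs with h2
      · rw [not_not.1 fun h3 => hcon ⟨h2, h3⟩, zero_smul]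
      · rfl
    have := hlie (h1 ▸ hf.coeff_grade _) htu (by omega) hα0 hα
    omega
  obtain ⟨hu2, hc⟩ := hu2
  have hr : 1 ≤ r := Nat.one_le_iff_ne_zero.2 fun h0 => by simp [h0] at hj'; omega
  have hd : d = 0 := by
    by_contra hd
    have h1 : (grade F _ v).coeff (2 * p) = 0 := by
      refine coeff_eq_zero_of_natDegree_lt ?_
      change deg F _ v < _
      rw [hu2, hi', hj']
      exact Nat.mul_lt_mul_of_pos_right hij hr
    rw [hgv, coeff_grade_twisted, if_pos rfl] at h1
    exact bracket_pow_add_ne_zero hp (hg.coeff_grade _) hd h1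
  subst hd
  rw [zero_smul, add_zero] at hgv
  subst hgv
  obtain rfl : j = 1 := hlie (hg.coeff_grade _) htv hj hβ0 hβ
  rw [one_mul] at hj'
  rw [pow_one] at hβ
  have ht : t = β⁻¹ • top F _ v := by rw [hβ, smul_smul, inv_mul_cancel₀ hβ0, one_smul]
  rw [htop_u, if_pos hu2, ht, _root_.smul_pow, smul_smul] at hα
  have hpi : p = i := IsLie.pow_eq_of_add_smul_pow (hf.coeff_grade _) isLie_bracket
    (hg.coeff_grade _) bracket_ne_zero htv hp (by omega) hc
    (mul_ne_zero hα0 (pow_ne_zero _ (inv_ne_zero hβ0))) hα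
  have hr2 : deg F _ v = 2 := by
    rw [hj']
    rw [hi', hpi, mul_comm] at hu2
    exact (Nat.eq_of_mul_eq_mul_left (by omega) hu2).symm
  obtain ⟨a', b', e', h0, h1, h2, h3⟩ := hg.exists_coeff
  -- `toPoly` reads off the coefficient of the first letter, which for a twisted element equals that
  -- of `bracket F ^ p`; for `v` it is zero.
  have ha' : a' = 0 := by
    have := congrArg (Polynomial.coeff · 1) ((h3 (toPoly F)).symm.trans hgd)
    simpa [toPoly] using this
  rw [ha', zero_smul, zero_add] at h1
  have he' : e' ≠ 0 := by
    rintro rfl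
    refine htv ?_
    change (grade F _ v).coeff (deg F _ v) = 0
    rw [hr2, h2, zero_smul]
  have hveq : v = b' • ι F 1 + e' • bracket F := by
    have h4 := eval_grade v
    have hr2' : (grade F _ v).natDegree = 2 := hr2
    rw [eval_eq_sum_range, hr2'] at h4
    simpa [Finset.sum_range_succ, h0, h1, h2] using h4.symm
  by_cases hb : b' = 0
  · obtain ⟨a, b, -, -, -, -, h5⟩ := hf.exists_coeff
    have ha : a = c := by
      have := congrArg (Polynomial.coeff · 1) ((h5 (toPoly F)).symm.trans hfc)
      simpa [toPoly] using this
    subst ha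
    -- Here `v` is a multiple of the commutator and dies in any commutative ring. The values of `ρ`
    -- are chosen to kill the linear part of `u`, hence all of `u`, but not the second letter.
    let ρ : FreeAlgebra F (Fin 2) →ₐ[F] F[X] := lift F ![(-(b / a)) • Polynomial.X, Polynomial.X]
    have hρ0 : ρ (ι F 0) = (-(b / a)) • Polynomial.X := by simp [ρ]
    have hρ1 : ρ (ι F 1) = Polynomial.X := by simp [ρ]
    have hρv : ρ v = 0 := by
      rw [hveq, hb, zero_smul, zero_add, map_smul, map_bracket, smul_zero]
    have hρu : ρ u = 0 := by
      rw [hfu, map_add, map_smul, map_pow, map_bracket, zero_pow (by omega), smul_zero, add_zero,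
        h5, hρ0, hρ1, smul_smul, ← add_smul, mul_neg, mul_div_cancel₀ _ hc, neg_add_cancel,
        zero_smul]
    obtain ⟨k, hk⟩ := exists_algebraMap_of_adjoin_eq_top h ρ hρu hρv (ι F 1)
    rw [hρ1] at hk
    have := congrArg (Polynomial.coeff · 1) hk
    simp [algebraMap_eq] at this
  -- The parameter `b' / e'` is the one for which `borel` kills `v`. Its image would be commutative,
  -- which it is not.
  · refine borel_not_commute (div_ne_zero hb he') (commute_of_adjoin_eq_top h _ ?_ _ _)
    rw [hveq, map_add, map_smul, map_smul, borel_bracket, smul_smul, ← add_smul, mul_neg,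
      mul_div_cancel₀ _ he', add_neg_cancel, zero_smul]

theorem IsTwisted.adjoin_ne_top {p : ℕ} (hp : 2 ≤ p) {u v : FreeAlgebra F (Fin 2)}
    (hu : IsTwisted p u) (hv : IsTwisted p v) : Algebra.adjoin F {u, v} ≠ ⊤ := by
  intro h
  induction hN : deg F _ u + deg F _ v using Nat.strong_induction_on generalizing u v with
  | _ N ih =>
    have hne : ∀ {u v : FreeAlgebra F (Fin 2)}, Algebra.adjoin F {u, v} = ⊤ → v ≠ 0 := by
      rintro u v h rfl
      exact ι_not_commute (commute_of_adjoin_eq_top h (AlgHom.id F _) rfl (ι F 0) (ι F 1))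
    have h' : Algebra.adjoin F {v, u} = ⊤ := by rwa [Set.pair_comm]
    have hv0 := hne h
    have hu0 := hne h'
    have hdeg : ∀ {u : FreeAlgebra F (Fin 2)}, u ≠ 0 → IsTwisted p u → 1 ≤ deg F _ u := by
      rintro u hu0 ⟨f, c, hf, -, hfu⟩
      by_contra hd
      apply top_ne_zero hu0
      change (grade F _ u).coeff (deg F _ u) = 0
      obtain ⟨-, -, -, h0, -⟩ := hf.exists_coeff
      rw [hfu, coeff_grade_twisted, ← hfu, if_neg (by omega), add_zero,
        show deg F (Fin 2) u = 0 by omega, h0]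
    have hdu := hdeg hu0 hu
    have hdv := hdeg hv0 hv
    -- A nonzero coefficient of `bracket F ^ p` puts a nonzero component in degree `2 * p`. If both
    -- coefficients vanish, `toPoly` kills `u` and `v` but not the first letter.
    have h2 : 2 ≤ deg F _ u ∨ 2 ≤ deg F _ v := by
      have hbig : ∀ {f : FreeAlgebra F (Fin 2)} {c : F}, IsLie f → c ≠ 0 →
          2 ≤ deg F _ (f + c • bracket F ^ p) := by
        intro f c hf hc
        refine le_trans (by omega : 2 ≤ 2 * p) (le_natDegree_of_ne_zero ?_)
        rw [coeff_grade_twisted, if_pos rfl]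
        exact bracket_pow_add_ne_zero hp (hf.coeff_grade _) hc
      obtain ⟨f, c, hf, hfc, rfl⟩ := hu
      obtain ⟨g, d, hg, hgd, rfl⟩ := hv
      by_cases hc : c = 0
      · by_cases hd : d = 0
        · exfalso
          subst hc hd
          obtain ⟨k, hk⟩ := exists_algebraMap_of_adjoin_eq_top h (toPoly F) (by simp [hfc])
            (by simp [hgd]) (ι F 0)
          have := congrArg (Polynomial.coeff · 1) hk
          simp [toPoly, algebraMap_eq] at this
        · exact .inr (hbig hg hd)
      · exact .inl (hbig hf hc)
    obtain ⟨x, hx, y, hy, hx0, hxy⟩ := top_dependent hdu hdv h ι_not_commute h2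
    obtain ⟨t, r, i, j, α, β, hi, hj, hα, hβ, hi', hj'⟩ :=
      exists_eq_smul_pow hdu hdv (top_mem u) (top_mem v) (top_ne_zero hu0) (top_ne_zero hv0)
        hx hy hx0 hxy
    rcases lt_trichotomy i j with hij | rfl | hij
    · exact false_of_top_eq_pow hp hv hu h' hv0 hu0 hi hij hβ hα hj' hi' hdu
    · have hβ0 : β ≠ 0 := by rintro rfl; exact top_ne_zero hv0 (by rw [hβ, zero_smul])
      have htop : top F _ u = (α / β) • top F _ v := by
        rw [hα, hβ, smul_smul, div_mul_cancel₀ _ hβ0]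
      have hduv : deg F _ v = deg F _ u := hj'.trans hi'.symm
      -- For equal exponents the leading components are proportional and cancel. The new pair is
      -- again twisted and generates the same algebra.
      have hlt : deg F _ (u + (-(α / β)) • v) < deg F _ u := by
        have hle : deg F _ (u + (-(α / β)) • v) ≤ deg F _ u := by
          rw [deg, map_add, map_smul]
          exact natDegree_add_le_of_degree_le le_rfl ((natDegree_smul_le _ _).trans hduv.le)
        refine lt_of_le_of_ne hle fun heq => ?_
        have h0 : (grade F _ (u + (-(α / β)) • v)).coeff (deg F _ u) = 0 := by
          have h3 : (grade F _ u).coeff (deg F _ u) = (α / β) • (grade F _ v).coeff (deg F _ u) := by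
            rw [top, top, leadingCoeff, leadingCoeff] at htop
            change _ = (α / β) • (grade F _ v).coeff (deg F _ v) at htop
            rwa [hduv] at htop
          rw [map_add, map_smul, coeff_add, coeff_smul, h3, neg_smul, add_neg_cancel]
        rw [← heq] at h0
        have h4 : u + (-(α / β)) • v = 0 := not_not.1 fun hn => top_ne_zero hn h0
        rw [h4, deg, map_zero, natDegree_zero] at heq
        omega
      refine ih _ ?_ (hu.add (hv.smul (-(α / β)))) hv ?_ rfl
      · omega
      · rw [eq_top_iff, ← h]
        refine Algebra.adjoin_le ?_
        have hv' : v ∈ Algebra.adjoin F {u + (-(α / β)) • v, v} := Algebra.subset_adjoin (by simp)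
        rintro z (rfl | rfl)
        · have h5 := sub_mem (Algebra.subset_adjoin (by simp) :
            z + (-(α / β)) • v ∈ Algebra.adjoin F {z + (-(α / β)) • v, v})
            (Subalgebra.smul_mem _ hv' (-(α / β)))
          rwa [add_sub_cancel_right] at h5
        · exact hv'
    · exact false_of_top_eq_pow hp hu hv h hu0 hv0 hj hij hα hβ hi' hj' hdv

end FreeAlgebra

/-! ### The enveloping algebra of the one-relator Lie algebra -/

namespace LieIdeal

variable {R L M : Type*} [CommRing R] [LieRing L] [LieAlgebra R L] [LieRing M] [LieAlgebra R M]

/-- The projection onto the quotient by an ideal, as a homomorphism of Lie algebras. -/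
def quotMk (I : LieIdeal R L) : L →ₗ⁅R⁆ L ⧸ I where
  __ := (LieSubmodule.Quotient.mk' I : L →ₗ[R] L ⧸ I)
  map_lie' := LieSubmodule.Quotient.mk_bracket I _ _

theorem quotMk_surjective (I : LieIdeal R L) : Function.Surjective I.quotMk :=
  LieSubmodule.Quotient.surjective_mk' I

/-- The homomorphism of Lie algebras induced on the quotient by an ideal. -/
def quotLift (I : LieIdeal R L) (φ : L →ₗ⁅R⁆ M) (h : ∀ x ∈ I, φ x = 0) : L ⧸ I →ₗ⁅R⁆ M where
  __ := I.toSubmodule.liftQ (φ : L →ₗ[R] M) h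
  map_lie' {a b} := by
    obtain ⟨x, rfl⟩ := I.quotMk_surjective a
    obtain ⟨y, rfl⟩ := I.quotMk_surjective b
    exact φ.map_lie x y

@[simp]
theorem quotLift_quotMk (I : LieIdeal R L) (φ : L →ₗ⁅R⁆ M) (h : ∀ x ∈ I, φ x = 0) (x : L) :
    I.quotLift φ h (I.quotMk x) = φ x := rfl

end LieIdeal

namespace FreeLieAlgebra

theorem eq_top_of_forall_of_mem {R X : Type*} [CommRing R]
    (K : LieSubalgebra R (FreeLieAlgebra R X)) (h : ∀ x, of R x ∈ K) : K = ⊤ := by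
  have h1 : K.incl.comp (lift R fun x => (⟨of R x, h x⟩ : K)) = LieHom.id :=
    hom_ext fun x => by simp
  refine eq_top_iff.2 fun f _ => ?_
  have h2 := LieHom.congr_fun h1 f
  rw [LieHom.comp_apply, LieHom.id_apply] at h2
  exact h2 ▸ (lift R (fun x => (⟨of R x, h x⟩ : K)) f).2

end FreeLieAlgebra

namespace OneRelator

attribute [local instance 100] LieRing.ofAssociativeRing

section Ad

variable {F : Type*} [Field F]

theorem map_adR_pow {L M : Type*} [LieRing L] [LieAlgebra F L] [LieRing M] [LieAlgebra F M]
    (φ : L →ₗ⁅F⁆ M) (x z : L) (n : ℕ) : φ ((adR F x ^ n) z) = (adR F (φ x) ^ n) (φ z) := by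
  induction n with
  | zero => simp
  | succ n ih =>
    rw [pow_succ', pow_succ', Module.End.mul_apply, Module.End.mul_apply, ← ih]
    exact φ.map_lie _ _

/-- `ad x` is the difference of the commuting operators of right and left multiplication, and `p`-th
powers are additive on these. -/
theorem adR_pow_char {A : Type*} [Ring A] [Algebra F A] [Nontrivial A] (p : ℕ) [CharP F p]
    [Fact p.Prime] (x z : A) : (adR F x ^ p) z = z * x ^ p - x ^ p * z := by
  have h : adR F x = LinearMap.mulRight F x - LinearMap.mulLeft F x := by
    ext z
    rfl
  have : CharP (Module.End F A) p :=
    charP_of_injective_algebraMap (algebraMap F (Module.End F A)).injective p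
  rw [h, sub_pow_char_of_commute _ (LinearMap.commute_mulLeft_right x x).symm, LinearMap.pow_mulRight,
    LinearMap.pow_mulLeft]
  rfl

end Ad

variable (F : Type*) [Field F] (p : ℕ)

/-- The images of the free generators in the quotient. -/
noncomputable def gen (i : Fin 3) : QuotLie F p := (relIdeal F p).quotMk (FreeLieAlgebra.of F i)

theorem gen_relation : gen F p 0 + ⁅gen F p 1, gen F p 2⁆ +
    (adR F (gen F p 0) ^ p) (gen F p 2) = 0 := by
  have h : (relIdeal F p).quotMk (relator F p) = 0 :=
    (LieSubmodule.Quotient.mk_eq_zero (N := relIdeal F p)).2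
      (LieSubmodule.subset_lieSpan (Set.mem_singleton _))
  rwa [relator, map_add, map_add, map_adR_pow, LieHom.map_lie] at h

variable {F p}

theorem eq_top_of_forall_gen_mem (K : LieSubalgebra F (QuotLie F p)) (h : ∀ i, gen F p i ∈ K) :
    K = ⊤ := by
  have h1 := FreeLieAlgebra.eq_top_of_forall_of_mem (K.comap (relIdeal F p).quotMk) h
  refine eq_top_iff.2 fun x _ => ?_
  obtain ⟨y, rfl⟩ := (relIdeal F p).quotMk_surjective x
  have h2 : y ∈ K.comap (relIdeal F p).quotMk := h1 ▸ LieSubalgebra.mem_top y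
  exact h2

theorem hom_ext {M : Type*} [LieRing M] [LieAlgebra F M] {φ ψ : QuotLie F p →ₗ⁅F⁆ M}
    (h : ∀ i, φ (gen F p i) = ψ (gen F p i)) : φ = ψ := by
  have h1 : φ.comp (relIdeal F p).quotMk = ψ.comp (relIdeal F p).quotMk :=
    FreeLieAlgebra.hom_ext h
  ext x
  obtain ⟨y, rfl⟩ := (relIdeal F p).quotMk_surjective x
  exact LieHom.congr_fun h1 y

section Lift

variable {M : Type*} [LieRing M] [LieAlgebra F M] (f : Fin 3 → M)
  (hf : f 0 + ⁅f 1, f 2⁆ + (adR F (f 0) ^ p) (f 2) = 0)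

/-- The homomorphism of Lie algebras with prescribed values on the generators. -/
noncomputable def lift : QuotLie F p →ₗ⁅F⁆ M :=
  (relIdeal F p).quotLift (FreeLieAlgebra.lift F f) (by
    have h : relIdeal F p ≤ (FreeLieAlgebra.lift F f).ker := by
      rw [LieSubmodule.lieSpan_le, Set.singleton_subset_iff, SetLike.mem_coe, LieHom.mem_ker,
        relator, map_add, map_add, map_adR_pow, LieHom.map_lie]
      simpa only [FreeLieAlgebra.lift_of_apply] using hf
    exact fun x hx => LieHom.mem_ker.1 (h hx))

@[simp]
theorem lift_gen (i : Fin 3) : lift f hf (gen F p i) = f i := by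
  rw [lift, gen, LieIdeal.quotLift_quotMk, FreeLieAlgebra.lift_of_apply]

end Lift

-- The commutator `w` cancels `[a, b]`, and `[w^p, b]` cancels `(ad w)^p (b) = b w^p - w^p b`.
open FreeAlgebra in
theorem freeAlgebra_relation [CharP F p] [Fact p.Prime] :
    (![bracket F, ι F 0 + bracket F ^ p, ι F 1] : Fin 3 → FreeAlgebra F (Fin 2)) 0 +
      ⁅(![bracket F, ι F 0 + bracket F ^ p, ι F 1] : Fin 3 → FreeAlgebra F (Fin 2)) 1,
        (![bracket F, ι F 0 + bracket F ^ p, ι F 1] : Fin 3 → FreeAlgebra F (Fin 2)) 2⁆ +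
      (adR F ((![bracket F, ι F 0 + bracket F ^ p, ι F 1] : Fin 3 → FreeAlgebra F (Fin 2)) 0) ^ p)
        ((![bracket F, ι F 0 + bracket F ^ p, ι F 1] : Fin 3 → FreeAlgebra F (Fin 2)) 2) = 0 := by
  simp only [Matrix.cons_val]
  rw [adR_pow_char, LieRing.of_associative_ring_bracket, add_mul, mul_add]
  nth_rw 1 [bracket]
  abel

variable (F p) in
/-- The homomorphism from the quotient to the free associative algebra. -/
noncomputable def toFree [CharP F p] [Fact p.Prime] : QuotLie F p →ₗ⁅F⁆ FreeAlgebra F (Fin 2) :=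
  lift _ freeAlgebra_relation

open UniversalEnvelopingAlgebra

instance {R L : Type*} [Field R] [LieRing L] [LieAlgebra R L] :
    Nontrivial (UniversalEnvelopingAlgebra R L) :=
  (Bialgebra.counitAlgHom R (UniversalEnvelopingAlgebra R L)).toRingHom.domain_nontrivial

variable (F p) in
/-- The homomorphism from the free associative algebra to the enveloping algebra. -/
noncomputable def fromFree : FreeAlgebra F (Fin 2) →ₐ[F] UniversalEnvelopingAlgebra F (QuotLie F p) :=
  FreeAlgebra.lift F ![ι F (gen F p 1) - ι F (gen F p 0) ^ p, ι F (gen F p 2)]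

theorem fromFree_ι_zero : fromFree F p (FreeAlgebra.ι F 0) =
    ι F (gen F p 1) - ι F (gen F p 0) ^ p := by
  simp [fromFree, -ι_apply]

theorem fromFree_ι_one : fromFree F p (FreeAlgebra.ι F 1) = ι F (gen F p 2) := by
  simp [fromFree, -ι_apply]

/-- The defining relation, rearranged as `x = z (y - x^p) - (y - x^p) z`; this is why `fromFree`
subtracts `x^p`. -/
theorem fromFree_bracket [CharP F p] [Fact p.Prime] :
    fromFree F p (FreeAlgebra.bracket F) = ι F (gen F p 0) := by
  have h := congrArg (ι F) (gen_relation F p)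
  rw [map_add, map_add, map_adR_pow, LieHom.map_lie, adR_pow_char,
    LieRing.of_associative_ring_bracket, map_zero] at h
  rw [FreeAlgebra.bracket, map_sub, map_mul, map_mul, fromFree_ι_zero, fromFree_ι_one, ← sub_eq_zero,
    ← neg_eq_zero, ← h]
  noncomm_ring

variable (F p) in
/-- The isomorphism of the free associative algebra with the enveloping algebra. -/
noncomputable def freeEquiv [CharP F p] [Fact p.Prime] :
    FreeAlgebra F (Fin 2) ≃ₐ[F] UniversalEnvelopingAlgebra F (QuotLie F p) :=
  .ofAlgHom (fromFree F p) (UniversalEnvelopingAlgebra.lift F (toFree F p))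
    (by
      apply algHom_ext
      intro x
      rw [AlgHom.comp_apply, lift_ι_apply]
      have h : (fromFree F p : FreeAlgebra F (Fin 2) →ₗ⁅F⁆ _).comp (toFree F p) = ι F := by
        refine hom_ext fun i => ?_
        rw [LieHom.comp_apply, toFree, lift_gen]
        fin_cases i
        · exact fromFree_bracket
        · change fromFree F p (FreeAlgebra.ι F 0 + FreeAlgebra.bracket F ^ p) = _
          rw [map_add, map_pow, fromFree_bracket, fromFree_ι_zero, sub_add_cancel]
          rfl
        · exact fromFree_ι_one
      exact LieHom.congr_fun h x)
    (by
      ext i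
      fin_cases i
      · simp [fromFree_ι_zero, toFree, -ι_apply, lift_ι_apply]
      · simp [fromFree_ι_one, toFree, -ι_apply, lift_ι_apply])

/-- `x ⊗ 1` and `1 ⊗ x` commute, so in characteristic `p` the `p`-th power of their sum is `x^p ⊗ 1
+ 1 ⊗ x^p`. -/
theorem comul_fromFree_ι_zero [CharP F p] [Fact p.Prime] :
    Coalgebra.comul (R := F) (fromFree F p (FreeAlgebra.ι F 0)) =
      fromFree F p (FreeAlgebra.ι F 0) ⊗ₜ[F] 1 + 1 ⊗ₜ[F] fromFree F p (FreeAlgebra.ι F 0) := by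
  set U := UniversalEnvelopingAlgebra F (QuotLie F p)
  have : CharP (U ⊗[F] U) p :=
    charP_of_injective_algebraMap (algebraMap F (U ⊗[F] U)).injective p
  have hc : Commute (ι F (gen F p 0) ⊗ₜ[F] (1 : U)) ((1 : U) ⊗ₜ[F] ι F (gen F p 0)) := by
    simp [Commute, SemiconjBy, -ι_apply]
  rw [fromFree_ι_zero, map_sub, Bialgebra.comul_pow, comul_ι, comul_ι,
    add_pow_char_of_commute _ hc, Algebra.TensorProduct.tmul_pow, Algebra.TensorProduct.tmul_pow,
    one_pow, TensorProduct.sub_tmul, TensorProduct.tmul_sub]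
  abel

theorem hopfIsomorphic [CharP F p] [Fact p.Prime] (hp : Odd p) :
    HopfIsomorphic F (UniversalEnvelopingAlgebra F (QuotLie F p)) (FreeAlgebra F (Fin 2)) := by
  have hS : ∀ a : FreeAlgebra F (Fin 2), fromFree F p (HopfAlgebra.antipode F a) =
      HopfAlgebra.antipode F (fromFree F p a) := by
    intro a
    induction a using FreeAlgebra.induction with
    | grade0 r => simp [Algebra.algebraMap_eq_smul_one]
    | grade1 x =>
      rw [FreeAlgebra.antipode_ι, map_neg]
      fin_cases x
      · have hpow : ∀ n : ℕ, HopfAlgebra.antipode F (ι F (gen F p 0) ^ n) =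
            HopfAlgebra.antipode F (ι F (gen F p 0)) ^ n := fun n => by
          induction n with
          | zero => simp
          | succ n ih => rw [pow_succ, pow_succ', HopfAlgebra.antipode_mul_antidistrib, ih]
        -- Oddness of `p` gives `(-x)^p = -x^p`.
        rw [Fin.zero_eta, fromFree_ι_zero, map_sub, hpow, antipode_ι, antipode_ι, hp.neg_pow]
        abel
      · rw [Fin.mk_one, fromFree_ι_one, antipode_ι]
    | mul a b ha hb =>
      rw [HopfAlgebra.antipode_mul_antidistrib, map_mul, ha, hb, map_mul,
        HopfAlgebra.antipode_mul_antidistrib]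
    | add a b ha hb => simp only [map_add, ha, hb]
  let e : FreeAlgebra F (Fin 2) ≃ₐc[F] UniversalEnvelopingAlgebra F (QuotLie F p) :=
    .ofAlgEquiv (freeEquiv F p)
      (by
        ext i
        change Coalgebra.counit (R := F) (fromFree F p (FreeAlgebra.ι F i)) =
          Coalgebra.counit (R := F) (FreeAlgebra.ι F i)
        rw [FreeAlgebra.counit_ι]
        fin_cases i
        · rw [Fin.zero_eta, fromFree_ι_zero, map_sub, Bialgebra.counit_pow, counit_ι, counit_ι,
            zero_pow (Nat.Prime.ne_zero Fact.out), sub_zero]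
        · rw [Fin.mk_one, fromFree_ι_one, counit_ι])
      (by
        ext i
        change Algebra.TensorProduct.map _ _ (Coalgebra.comul (R := F) (FreeAlgebra.ι F i)) =
          Coalgebra.comul (R := F) (fromFree F p (FreeAlgebra.ι F i))
        have h : Coalgebra.comul (R := F) (fromFree F p (FreeAlgebra.ι F i)) =
            fromFree F p (FreeAlgebra.ι F i) ⊗ₜ[F] 1 +
              1 ⊗ₜ[F] fromFree F p (FreeAlgebra.ι F i) := by
          fin_cases i
          · exact comul_fromFree_ι_zero
          · rw [Fin.mk_one, fromFree_ι_one, comul_ι]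
        rw [h, FreeAlgebra.comul_ι, map_add, Algebra.TensorProduct.map_tmul,
          Algebra.TensorProduct.map_tmul, map_one]
        rfl)
  refine ⟨e.symm, fun a => ?_⟩
  obtain ⟨b, rfl⟩ := e.surjective a
  have h1 : HopfAlgebra.antipode F (e b) = e (HopfAlgebra.antipode F b) := (hS b).symm
  change e.symm (HopfAlgebra.antipode F (e b)) = HopfAlgebra.antipode F (e.symm (e b))
  rw [h1]
  exact (e.toEquiv.symm_apply_apply _).trans (congrArg _ (e.toEquiv.symm_apply_apply b).symm)

/-! ### Generators of the one-relator Lie algebra -/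

theorem _root_.FreeAlgebra.IsLie.adR_pow {X : Type*} {f g : FreeAlgebra F X} (hf : f.IsLie)
    (hg : g.IsLie) (n : ℕ) : ((adR F f ^ n) g).IsLie := by
  induction n with
  | zero => exact hg
  | succ n ih =>
    rw [pow_succ', Module.End.mul_apply]
    exact ih.comm hf

open FreeAlgebra in
variable (F p) in
/-- The Lie subalgebra of the free algebra formed by the elements satisfying `IsTwisted`. -/
def twisted [CharP F p] [Fact p.Prime] : LieSubalgebra F (FreeAlgebra F (Fin 2)) where
  carrier := {u | IsTwisted p u}
  add_mem' := IsTwisted.add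
  zero_mem' := ⟨0, 0, .zero 0, by simp, by simp⟩
  smul_mem' r _ h := h.smul r
  lie_mem' := by
    rintro _ _ ⟨f, c, hf, -, rfl⟩ ⟨g, d, hg, -, rfl⟩
    -- The mixed terms `[f, w^p] = (ad w)^p (f)` and `[g, w^p]` are Lie elements again. The new
    -- coefficient of `w^p` is zero because commutators vanish in a polynomial ring.
    refine ⟨(f * g - g * f) + d • (adR F (bracket F) ^ p) f - c • (adR F (bracket F) ^ p) g, 0,
      ((hf.comm hg).add ((isLie_bracket.adR_pow hf p).smul d)).sub
        ((isLie_bracket.adR_pow hg p).smul c), ?_, ?_⟩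
    · simp [adR_pow_char, mul_comm]
    · rw [adR_pow_char, adR_pow_char, LieRing.of_associative_ring_bracket, zero_smul, add_zero]
      simp only [add_mul, mul_add, smul_mul_assoc, mul_smul_comm, smul_sub]
      rw [smul_add, smul_add, smul_comm c d]
      abel

open FreeAlgebra in
theorem isTwisted_toFree [CharP F p] [Fact p.Prime] (x : QuotLie F p) :
    IsTwisted p (toFree F p x) := by
  have h : (twisted F p).comap (toFree F p) = ⊤ := by
    refine eq_top_of_forall_gen_mem _ fun i => ?_
    rw [LieSubalgebra.mem_comap, toFree, lift_gen]
    fin_cases i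
    · exact ⟨bracket F, 0, isLie_bracket, by rw [map_bracket, zero_smul], by simp⟩
    · exact ⟨FreeAlgebra.ι F 0, 1, .of 0, by simp [toPoly], by simp⟩
    · exact ⟨FreeAlgebra.ι F 1, 0, .of 1, by simp [toPoly], by simp⟩
  have hx : x ∈ (twisted F p).comap (toFree F p) := h ▸ LieSubalgebra.mem_top x
  exact hx

/-- The Lie algebra underlying a subalgebra of an associative algebra. -/
def lieOfSubalgebra {A : Type*} [Ring A] [Algebra F A] (S : Subalgebra F A) : LieSubalgebra F A where
  __ := Subalgebra.toSubmodule S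
  lie_mem' hx hy := sub_mem (mul_mem hx hy) (mul_mem hy hx)

/-- Lie generators of `L` map to associative generators of the free algebra, since the image of `L`
generates it: the first letter is `(a + w^p) - w^p`. -/
theorem lieSpan_pair_ne_top [CharP F p] [Fact p.Prime] (x y : QuotLie F p) :
    LieSubalgebra.lieSpan F (QuotLie F p) {x, y} ≠ ⊤ := by
  intro h
  refine FreeAlgebra.IsTwisted.adjoin_ne_top (Nat.Prime.two_le Fact.out) (isTwisted_toFree x)
    (isTwisted_toFree y) ?_
  set S := Algebra.adjoin F {toFree F p x, toFree F p y}
  have hS : ∀ i, (![FreeAlgebra.bracket F, FreeAlgebra.ι F 0 + FreeAlgebra.bracket F ^ p,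
      FreeAlgebra.ι F 1] : Fin 3 → FreeAlgebra F (Fin 2)) i ∈ S := by
    have h1 : LieSubalgebra.lieSpan F (QuotLie F p) {x, y} ≤
        (lieOfSubalgebra S).comap (toFree F p) := by
      rw [LieSubalgebra.lieSpan_le]
      rintro z (rfl | rfl)
      · exact Algebra.subset_adjoin (by simp)
      · exact Algebra.subset_adjoin (by simp)
    intro i
    have h2 : gen F p i ∈ (lieOfSubalgebra S).comap (toFree F p) :=
      h1 (h ▸ LieSubalgebra.mem_top _)
    rw [LieSubalgebra.mem_comap, toFree, lift_gen] at h2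
    exact h2
  rw [eq_top_iff, ← FreeAlgebra.adjoin_range_ι]
  refine Algebra.adjoin_le ?_
  rintro _ ⟨i, rfl⟩
  fin_cases i
  · have h3 := sub_mem (hS 1) (pow_mem (hS 0) p)
    simpa using h3
  · exact hS 2

theorem generatedBy_three [CharP F p] [Fact p.Prime] : GeneratedBy F (QuotLie F p) 3 := by
  classical
  -- `GeneratedBy` asks for exactly three elements, so the generators must be distinct; their images
  -- in the free algebra are.
  have hinj : Function.Injective (gen F p) := by
    have h : Function.Injective (![FreeAlgebra.bracket F,
        FreeAlgebra.ι F 0 + FreeAlgebra.bracket F ^ p, FreeAlgebra.ι F 1] :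
        Fin 3 → FreeAlgebra F (Fin 2)) := by
      have hp0 : p ≠ 0 := Nat.Prime.ne_zero Fact.out
      have h01 : FreeAlgebra.bracket F ≠ FreeAlgebra.ι F 0 + FreeAlgebra.bracket F ^ p := fun h => by
        have := congrArg (FreeAlgebra.toPoly F) h
        rw [map_add, map_pow, FreeAlgebra.map_bracket, zero_pow hp0] at this
        simp [FreeAlgebra.toPoly, Polynomial.X_ne_zero.symm] at this
      have h12 : FreeAlgebra.ι F 0 + FreeAlgebra.bracket F ^ p ≠ FreeAlgebra.ι F 1 := fun h => by
        have := congrArg (FreeAlgebra.toPoly F) h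
        rw [map_add, map_pow, FreeAlgebra.map_bracket, zero_pow hp0] at this
        simp [FreeAlgebra.toPoly] at this
      have h02 : FreeAlgebra.bracket F ≠ FreeAlgebra.ι F 1 := fun h => by
        have := FreeAlgebra.words_disjoint FreeAlgebra.bracket_ne_zero
          FreeAlgebra.bracket_mem_words (h ▸ FreeAlgebra.ι_mem_words 1)
        omega
      intro i j hij
      fin_cases i <;> fin_cases j
      · rfl
      · exact absurd hij h01
      · exact absurd hij h02
      · exact absurd hij.symm h01
      · rfl
      · exact absurd hij h12
      · exact absurd hij.symm h02
      · exact absurd hij.symm h12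
      · rfl
    intro i j hij
    apply h
    have := congrArg (toFree F p) hij
    rwa [toFree, lift_gen, lift_gen] at this
  refine ⟨Finset.univ.image (gen F p), ?_, ?_⟩
  · rw [Finset.card_image_of_injective _ hinj, Finset.card_univ, Fintype.card_fin]
  · exact eq_top_of_forall_gen_mem _ fun i => LieSubalgebra.subset_lieSpan (by simp)

theorem three_le_of_generatedBy [CharP F p] [Fact p.Prime] {n : ℕ}
    (h : GeneratedBy F (QuotLie F p) n) : 3 ≤ n := by
  classical
  obtain ⟨s, rfl, hs⟩ := h
  by_contra! hlt
  obtain ⟨x, y, hxy⟩ : ∃ x y, s ⊆ {x, y} := by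
    have : s.card = 0 ∨ s.card = 1 ∨ s.card = 2 := by omega
    rcases this with h | h | h
    · exact ⟨0, 0, by simp [Finset.card_eq_zero.1 h]⟩
    · obtain ⟨x, rfl⟩ := Finset.card_eq_one.1 h
      exact ⟨x, x, by simp⟩
    · obtain ⟨x, y, -, rfl⟩ := Finset.card_eq_two.1 h
      exact ⟨x, y, le_rfl⟩
  refine lieSpan_pair_ne_top x y (eq_top_iff.2 ?_)
  rw [← hs]
  exact LieSubalgebra.lieSpan_mono fun z hz => by simpa using hxy hz

-- As two elements never generate `L`, a free generating set has three distinct members, which can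
-- be sent to independent elements of an abelian Lie algebra. Every homomorphism from `L` to an
-- abelian Lie algebra has image spanned by the images of `y` and `z`.
open Polynomial in
theorem not_isFreeLieAlgebra [CharP F p] [Fact p.Prime] :
    ¬ IsFreeLieAlgebra.{w} F (QuotLie F p) := by
  classical
  rintro ⟨Y, ⟨e⟩⟩
  have key : ∀ f g : FreeLieAlgebra F Y,
      ¬ ∀ y, FreeLieAlgebra.of F y = f ∨ FreeLieAlgebra.of F y = g := by
    intro f g h
    refine lieSpan_pair_ne_top (e f) (e g) (eq_top_iff.2 ?_)
    have h1 := FreeLieAlgebra.eq_top_of_forall_of_mem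
      ((LieSubalgebra.lieSpan F (QuotLie F p) {e f, e g}).comap e.toLieHom) fun y => by
        rcases h y with hy | hy
        · rw [hy]
          exact LieSubalgebra.subset_lieSpan (by simp)
        · rw [hy]
          exact LieSubalgebra.subset_lieSpan (by simp)
    intro x _
    have h2 : e.symm x ∈ (LieSubalgebra.lieSpan F (QuotLie F p) {e f, e g}).comap e.toLieHom :=
      h1 ▸ LieSubalgebra.mem_top _
    have h3 : e (e.symm x) ∈ LieSubalgebra.lieSpan F (QuotLie F p) {e f, e g} := h2
    rwa [LieEquiv.apply_symm_apply] at h3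
  obtain ⟨y0, -⟩ := not_forall.1 (key 0 0)
  obtain ⟨y1, hy1⟩ := not_forall.1 (key (.of F y0) (.of F y0))
  obtain ⟨y2, hy2⟩ := not_forall.1 (key (.of F y0) (.of F y1))
  have h10 : y1 ≠ y0 := by rintro rfl; exact hy1 (.inl rfl)
  have h20 : y2 ≠ y0 := by rintro rfl; exact hy2 (.inl rfl)
  have h21 : y2 ≠ y1 := by rintro rfl; exact hy2 (.inr rfl)
  -- `F[X]` serves only as an abelian Lie algebra of dimension at least three; `y0, y1, y2` go to
  -- `1, X, X²`.
  let q : FreeLieAlgebra F Y →ₗ⁅F⁆ F[X] := FreeLieAlgebra.lift F fun y =>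
    monomial (if y = y0 then 0 else if y = y1 then 1 else 2) 1
  let ψ : QuotLie F p →ₗ⁅F⁆ F[X] := q.comp e.symm.toLieHom
  have hlie : ∀ f g : F[X], ⁅f, g⁆ = 0 := fun f g => by
    rw [LieRing.of_associative_ring_bracket, mul_comm, sub_self]
  -- In an abelian target the defining relation reduces to `x = 0`.
  have h0 : ψ (gen F p 0) = 0 := by
    have h := congrArg ψ (gen_relation F p)
    rw [map_add, map_add, LieHom.map_lie, hlie, map_adR_pow, map_zero, add_zero] at h
    have h2 : ∀ f : F[X], adR F f = 0 := fun f => LinearMap.ext fun g => hlie g f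
    rwa [h2, zero_pow (Nat.Prime.ne_zero Fact.out), LinearMap.zero_apply, add_zero] at h
  let K : LieSubalgebra F F[X] :=
    { Submodule.span F {ψ (gen F p 1), ψ (gen F p 2)} with
      lie_mem' := fun {f g} _ _ => by
        rw [hlie]
        exact Submodule.zero_mem _ }
  have hK : K.comap ψ = ⊤ := by
    refine eq_top_of_forall_gen_mem _ fun i => ?_
    change ψ (gen F p i) ∈ Submodule.span F {ψ (gen F p 1), ψ (gen F p 2)}
    fin_cases i
    · rw [Fin.zero_eta, h0]
      exact zero_mem _
    · exact Submodule.subset_span (by simp)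
    · exact Submodule.subset_span (by simp)
  have hq : ∀ f, q f ∈ Submodule.span F
      (({ψ (gen F p 1), ψ (gen F p 2)} : Finset F[X]) : Set F[X]) := by
    intro f
    have h1 : e f ∈ K.comap ψ := hK ▸ LieSubalgebra.mem_top _
    have h2 : ψ (e f) ∈ Submodule.span F {ψ (gen F p 1), ψ (gen F p 2)} := h1
    rw [Finset.coe_pair]
    change q (e.symm (e f)) ∈ _ at h2
    rwa [LieEquiv.symm_apply_apply] at h2
  have hind : LinearIndependent F fun i : Fin 3 => (monomial (i : ℕ) (1 : F)) :=
    by simpa [Function.comp_def] using (basisMonomials F).linearIndependent.comp _ Fin.val_injective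
  have hcard := linearIndependent_le_span' _ hind
    ({ψ (gen F p 1), ψ (gen F p 2)} : Finset F[X]) (by
      rintro _ ⟨i, rfl⟩
      fin_cases i
      · simpa [q] using hq (.of F y0)
      · simpa [q, h10] using hq (.of F y1)
      · simpa [q, h20, h21] using hq (.of F y2))
  rw [Cardinal.mk_fin, Nat.cast_le] at hcard
  have h2 : Fintype.card ({ψ (gen F p 1), ψ (gen F p 2)} : Finset F[X]) ≤ 2 := by
    rw [Fintype.card_coe]
    exact Finset.card_le_two
  exact absurd (hcard.trans h2) (by norm_num)

end OneRelator

theorem mainTheorem6 (F : Type u) [Field F] (p : ℕ) [CharP F p] (hp : Odd p) :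
    ¬ IsFreeLieAlgebra.{w} F (OneRelator.QuotLie F p) ∧
    HopfIsomorphic F (UniversalEnvelopingAlgebra F (OneRelator.QuotLie F p))
      (FreeAlgebra F (Fin 2)) ∧
    IsLeast {n : ℕ | GeneratedBy F (OneRelator.QuotLie F p) n} 3 := by
  -- Oddness excludes characteristic zero, so `p` is prime.
  have hp0 : p ≠ 0 := by rintro rfl; simp at hp
  have : Fact p.Prime := ⟨(CharP.char_is_prime_or_zero F p).resolve_right hp0⟩
  exact ⟨OneRelator.not_isFreeLieAlgebra, OneRelator.hopfIsomorphic hp,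
    OneRelator.generatedBy_three, fun _ => OneRelator.three_le_of_generatedBy⟩
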